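/- Let $p$ be an odd prime and let $\mathbb{C}_p$ be the completion of an algebraic closure of $\mathbb{Q}_p$, with $|p|_p=1/p$. Write $D^{+}(c,s)=\{x:|x-c|_p\le s\}$ and $D^{-}(c,s)=\{x:|x-c|_p<s\}$. For $a\neq b$ in $\mathbb{C}_p$, the arc $\mathcal{A}(a,b)$ of the circle $\{x:|x-a|_p=|b-a|_p\}$ is $D^{-}(b,|b-a|_p)$. For $\alpha\in\mathbb{Z}_{\ge 0}$ let $\Phi_\alpha$ be the family of the sequences $\varphi(k)=\alpha+\lambda k$, $\lambda=1,2,\dots$. For $f:\mathcal{A}(a,b)\to\mathbb{C}_p$ put $$A_{f}(n)=p^{-n}\sum_{\zeta^{p^{n}}=1}(x-a)f(x),\qquad x=a+(b-a)\zeta .$$ We say that $\int_{\mathcal{A}(a,b),\Phi_\alpha}f(x)\,dx$ exists and equals $L\in\mathbb{C}_p$ if for every $\varepsilon>0$ there are $\varphi\in\Phi_\alpha$ and $K$ such that $|A_f(\varphi(k))-L|_p<\varepsilon$ for all $k>K$ (such an $L$ is unique). A function is Krasner analytic on a set $\mathcal{D}\subseteq\mathbb{C}_p$ if on $\mathcal{D}$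 it is the uniform limit of rational functions without poles in $\mathcal{D}$. **Theorem (Cauchy–Goursat).** Let $R>0$, let $\mathcal{C}$ be the circle with centre $a$ and radius $R$, let $0\le m\le M$, and let $$\mathcal{D}=D^{+}(a,R)\setminus\bigcup_{i=1}^{M}D^{-}(x_i,\rho_i),$$ where $\rho_i=R$ for $i\le m$ and $0<\rho_i<R$ for $m<i\le M$. Suppose that $|a-x_i|_p=R$ for $i\le m$ and that the discs $D^{-}(x_i,\rho_i)$ are mutually disjoint. Let $b\in\mathcal{C}$ with $|b-x_i|_p=R$ for all $i$. Let $\mathcal{C}_i$ be the circle with centre $x_i$ and radius $r_i$, where $\rho_i\le r_i\le R$, and suppose that the discs $D^{+}(x_i,r_i)$, $i>m$, are mutually disjoint. For each $i$ let $b_i\in\mathcal{C}_i\cap\mathcal{D}$, and suppose that for $1\le i\le m$ we have $|b_i-x_j|_p=R$ for all $j\in\{1,\dots,M\}$ and $|b_i-b_j|_p=R$ for all $j\in\{1,\dots,M\}$ with $j\ne i$. Let $\alpha\in\mathbb{Z}_{\ge 0}$. Then there are constants $\mu_1,\dots,\mu_M\in\mathbb{C}_p$, depending only on $\alpha$, on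 the region $\mathcal{D}$ with its choice of boundary circle $\mathcal{C}$, and on the arcs $\mathcal{A}(a,b)$ of $\mathcal{C}$ and $\mathcal{A}(x_i,b_i)$ of $\mathcal{C}_i$ (circles and arcs as point sets, not on the choice of the points $a$, $b$, $x_i$, $b_i$ representing them), such that for every function $f$ that is Krasner analytic on $\mathcal{D}$ all the integrals below exist and $$\int_{\mathcal{A}(a,b),\Phi_\alpha}f(x)\,dx=\sum_{i=1}^{M}\mu_i\int_{\mathcal{A}(x_i,b_i),\Phi_\alpha}f(x)\,dx .$$ -/

import Mathlib

open Filter Topology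

noncomputable section

namespace PadicArc

/-- A path sequence: positive integer valued and strictly increasing from some index on. The values
before that index are irrelevant. -/
def IsPathSeq (φ : ℕ → ℕ) : Prop :=
  ∃ k₀ : ℕ, 0 < k₀ ∧ (∀ k, k₀ ≤ k → 0 < φ k) ∧ StrictMonoOn φ (Set.Ici k₀)

/-- From some index on, `φ` is a subsequence of `ψ`. -/
def IsTailSubseq (φ ψ : ℕ → ℕ) : Prop :=
  ∃ (k₀ : ℕ) (g : ℕ → ℕ), StrictMonoOn g (Set.Ici k₀) ∧ ∀ k, k₀ ≤ k → φ k = ψ (g k)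

/-- A non-empty family of path sequences, any two of which have a common subsequence (from some
index on) in the family. -/
structure Interlocked (Φ : Set (ℕ → ℕ)) : Prop where
  nonempty : Φ.Nonempty
  isPathSeq : ∀ φ ∈ Φ, IsPathSeq φ
  common : ∀ φ₁ ∈ Φ, ∀ φ₂ ∈ Φ, ∃ φ₃ ∈ Φ, IsTailSubseq φ₃ φ₁ ∧ IsTailSubseq φ₃ φ₂

/-- The family `Φ_α` of the sequences `k ↦ α + l * k` with `l = 1, 2, …`. -/
def linFamily (α : ℕ) : Set (ℕ → ℕ) :=
  {φ | ∃ l : ℕ, 0 < l ∧ ∀ k, φ k = α + l * k}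

theorem linFamily_interlocked (α : ℕ) : Interlocked (linFamily α) where
  nonempty := ⟨fun k => α + 1 * k, 1, one_pos, fun _ => rfl⟩
  isPathSeq := by
    rintro φ ⟨l, hl, h⟩
    refine ⟨1, one_pos, fun k hk => ?_, fun i _ j _ hij => ?_⟩
    · rw [h]; have := Nat.mul_pos hl hk; omega
    · rw [h, h]; have := Nat.mul_lt_mul_of_pos_left hij hl; omega
  common := by
    rintro φ₁ ⟨l₁, h₁, e₁⟩ φ₂ ⟨l₂, h₂, e₂⟩
    refine ⟨fun k => α + (l₁ * l₂) * k, ⟨l₁ * l₂, Nat.mul_pos h₁ h₂, fun _ => rfl⟩,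
      ⟨0, fun k => l₂ * k, fun i _ j _ hij => Nat.mul_lt_mul_of_pos_left hij h₂, fun k _ => ?_⟩,
      ⟨0, fun k => l₁ * k, fun i _ j _ hij => Nat.mul_lt_mul_of_pos_left hij h₁, fun k _ => ?_⟩⟩
    · rw [e₁]; ring
    · rw [e₂]; ring

variable {p : ℕ} [Fact p.Prime]

/-- The arc `𝒜(a, b)`, at the point `b`, of the circle with centre `a` and radius `|b - a|`. -/
def arc (a b : ℂ_[p]) : Set ℂ_[p] := Metric.ball b ‖b - a‖

/-- `p ^ (-n) * ∑ (x - a) * f x`, where `x = a + (b - a) * ζ` and `ζ` runs through the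
`p ^ n`-th roots of unity. For `a ≠ b` all these points `x` lie in `arc a b`. -/
def arcMean (a b : ℂ_[p]) (f : ℂ_[p] → ℂ_[p]) (n : ℕ) : ℂ_[p] :=
  ((p : ℂ_[p]) ^ n)⁻¹ * ∑ ζ ∈ Polynomial.nthRootsFinset (p ^ n) (1 : ℂ_[p]),
    ((a + (b - a) * ζ) - a) * f (a + (b - a) * ζ)

/-- `L` is the line integral of `f` on `𝒜(a, b)` with respect to the family `Φ`. -/
def HasArcIntegral (Φ : Set (ℕ → ℕ)) (a b : ℂ_[p]) (f : ℂ_[p] → ℂ_[p]) (L : ℂ_[p]) : Prop :=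
  ∀ ε : ℝ, 0 < ε → ∃ φ ∈ Φ, ∃ K : ℕ, ∀ k, K < k → ‖arcMean a b f (φ k) - L‖ < ε

theorem IsTailSubseq.exists_eq {φ ψ : ℕ → ℕ} (h : IsTailSubseq φ ψ) (K : ℕ) :
    ∃ N : ℕ, ∀ k, N ≤ k → ∃ j, K < j ∧ φ k = ψ j := by
  obtain ⟨k₀, g, hg, e⟩ := h
  have key : ∀ n, n ≤ g (k₀ + n) := by
    intro n
    induction n with
    | zero => exact Nat.zero_le _
    | succ n ih =>
      have : g (k₀ + n) < g (k₀ + (n + 1)) :=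
        hg (Set.mem_Ici.2 (by omega)) (Set.mem_Ici.2 (by omega)) (by omega)
      omega
  refine ⟨k₀ + (K + 1), fun k hk => ⟨g k, ?_, e k (by omega)⟩⟩
  have := key (k - k₀)
  rw [Nat.add_sub_cancel' (by omega)] at this
  omega

/-- The value of the integral with respect to an interlocked family is unique. -/
theorem HasArcIntegral.unique {Φ : Set (ℕ → ℕ)} (hΦ : Interlocked Φ) {a b : ℂ_[p]}
    {f : ℂ_[p] → ℂ_[p]} {L₁ L₂ : ℂ_[p]} (h₁ : HasArcIntegral Φ a b f L₁)
    (h₂ : HasArcIntegral Φ a b f L₂) : L₁ = L₂ := by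
  refine eq_of_forall_dist_le fun ε hε => ?_
  obtain ⟨φ₁, m₁, K₁, H₁⟩ := h₁ (ε / 2) (half_pos hε)
  obtain ⟨φ₂, m₂, K₂, H₂⟩ := h₂ (ε / 2) (half_pos hε)
  obtain ⟨φ, -, s₁, s₂⟩ := hΦ.common φ₁ m₁ φ₂ m₂
  obtain ⟨N₁, t₁⟩ := s₁.exists_eq K₁
  obtain ⟨N₂, t₂⟩ := s₂.exists_eq K₂
  obtain ⟨j₁, l₁, e₁⟩ := t₁ (max N₁ N₂) (le_max_left _ _)
  obtain ⟨j₂, l₂, e₂⟩ := t₂ (max N₁ N₂) (le_max_right _ _)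
  have q₁ := H₁ j₁ l₁
  have q₂ := H₂ j₂ l₂
  rw [← e₁, ← dist_eq_norm] at q₁
  rw [← e₂, ← dist_eq_norm] at q₂
  have := dist_triangle_left L₁ L₂ (arcMean a b f (φ (max N₁ N₂)))
  linarith

/-- The line integral of `f` on `𝒜(a, b)` with respect to `Φ` exists. -/
def ArcIntegrable (Φ : Set (ℕ → ℕ)) (a b : ℂ_[p]) (f : ℂ_[p] → ℂ_[p]) : Prop :=
  ∃ L, HasArcIntegral Φ a b f L

open Classical in
/-- The line integral of `f` on `𝒜(a, b)` with respect to `Φ` (and `0` if it does not exist). -/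
def arcIntegral (Φ : Set (ℕ → ℕ)) (a b : ℂ_[p]) (f : ℂ_[p] → ℂ_[p]) : ℂ_[p] :=
  if h : ArcIntegrable Φ a b f then h.choose else 0

theorem HasArcIntegral.arcIntegral_eq {Φ : Set (ℕ → ℕ)} (hΦ : Interlocked Φ) {a b : ℂ_[p]}
    {f : ℂ_[p] → ℂ_[p]} {L : ℂ_[p]} (h : HasArcIntegral Φ a b f L) :
    arcIntegral Φ a b f = L := by
  have h' : ArcIntegrable Φ a b f := ⟨L, h⟩
  rw [arcIntegral, dif_pos h']
  exact HasArcIntegral.unique hΦ h'.choose_spec h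

/-- `D⁺(a, R) \ ⋃ i, D⁻(x i, ρ i)`. -/
def holedDisc {M : ℕ} (a : ℂ_[p]) (R : ℝ) (x : Fin M → ℂ_[p]) (ρ : Fin M → ℝ) : Set ℂ_[p] :=
  Metric.closedBall a R \ ⋃ i, Metric.ball (x i) (ρ i)

/-- `f` is, on `D`, a uniform limit of rational functions having no poles in `D`. -/
def KrasnerAnalyticOn (f : ℂ_[p] → ℂ_[p]) (D : Set ℂ_[p]) : Prop :=
  ∃ P Q : ℕ → Polynomial ℂ_[p], (∀ n, ∀ z ∈ D, (Q n).eval z ≠ 0) ∧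
    TendstoUniformlyOn (fun n z => (P n).eval z / (Q n).eval z) f atTop D

end PadicArc

end

/-!
The proof computes all integrals by residues, with a weight for every pole. For a simple pole `c`
outside the arc `𝒜(a, b)` the mean of `(z - c)⁻¹` over the `p ^ n`-th roots of unity is
`(1 - u ^ p ^ n)⁻¹` with `u = (c - a) / (b - a)` (`arcMean_inv_sub`), while the means of a polynomial
vanish for large `n`. If `‖u‖ > 1` the weight tends to `0`. If `‖u‖ ≤ 1` then, modulo the maximal
ideal, `u` is fixed by some power of the Frobenius, so that `u ^ p ^ n` and with it the weight
converge along the family `Φ_α` (`exists_tendsto_pow`, `exists_tendsto_weight`). The limit depends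
only on the residue class of `u`, hence only on the hole that contains `c`
(`tendsto_weight_sub`, `IsConfig.tendsto_weight_sub_center`).

Two facts reduce the theorem to simple poles. On a closed set, every Krasner analytic function is a
uniform limit of linear combinations of powers of `z` and simple fractions, a double pole being the
limit of two simple ones (`KrasnerAnalyticOn.approximable`). And the means on an arc inside the
domain are bounded by the supremum of the function, uniformly in `n`, in spite of the denominator
`p ^ n` (`Approximable.norm_arcMean_le`): the function is a power series on the open disc around `b`,
its coefficients satisfy Cauchy's estimate, and `p ^ (-n) * ∑ ζ * (ζ - 1) ^ k` is an integer. So the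
integrals exist, and a linear relation between them holds as soon as it holds for simple poles
(`Approximable.tendsto_sum_arcMean`).

It remains to express the weights of the holes on `𝒜(a, b)` as a combination of their weights on the
arcs `𝒜(x i, b' i)`. Modulo the maximal ideal, the square matrix of the latter has two kinds of
rows: for the circles of radius `R`, rows proportional to the Frobenius image of the Cauchy matrix
`1 / (b' i - x j)`, and for the smaller circles, rows of the identity matrix. Its determinant is
therefore a unit for every `n` (`IsConfig.norm_det_weightMatrix`), and the limit matrix is
invertible. Finally, circles and arcs that agree as point sets have the same radius, since `p` is
odd, and congruent representing points, so they give the same integrals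
(`Approximable.arcIntegral_eq`), and one set of coefficients serves all representations.
-/

noncomputable section

namespace PadicArc

variable {p : ℕ} [Fact p.Prime]

/-! ### The residue field -/

theorem norm_sub_le_max (x y : ℂ_[p]) : ‖x - y‖ ≤ max ‖x‖ ‖y‖ := by
  simpa [sub_eq_add_neg] using IsUltrametricDist.norm_add_le_max x (-y)

theorem norm_natCast_le_one (n : ℕ) : ‖(n : ℂ_[p])‖ ≤ 1 :=
  IsUltrametricDist.norm_natCast_le_one _ _

theorem norm_p_lt_one : ‖(p : ℂ_[p])‖ < 1 := by
  rw [← map_natCast (algebraMap ℚ_[p] ℂ_[p]), norm_algebraMap']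
  exact Padic.norm_p_lt_one

/-- Two elements at distance less than the norm of one of them have the same norm. -/
theorem norm_eq_of_norm_sub_lt {x y : ℂ_[p]} (h : ‖x - y‖ < ‖y‖) : ‖x‖ = ‖y‖ := by
  have := IsUltrametricDist.norm_add_eq_max_of_norm_ne_norm (x := x - y) (y := y) h.ne
  rwa [sub_add_cancel, max_eq_right h.le] at this

theorem norm_eq_of_norm_sub_lt' {x y : ℂ_[p]} {R : ℝ} (h : ‖x - y‖ < R) (hy : ‖y‖ = R) :
    ‖x‖ = R := by
  rw [← hy] at h ⊢
  exact norm_eq_of_norm_sub_lt h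

variable (p) in
/-- The ring of integers of `ℂ_[p]`, as the unit ball of the norm. -/
abbrev unitBall : ValuationSubring ℂ_[p] :=
  (NormedField.valuation (K := ℂ_[p])).valuationSubring

theorem mem_unitBall {x : ℂ_[p]} : x ∈ unitBall p ↔ ‖x‖ ≤ 1 := by
  rw [Valuation.mem_valuationSubring_iff, NormedField.valuation_apply, ← NNReal.coe_le_coe]
  simp

variable (p) in
/-- The residue field of `ℂ_[p]`. -/
abbrev resField : Type := IsLocalRing.ResidueField (unitBall p)

variable (p) in
/-- Reduction modulo the maximal ideal. -/
abbrev res : unitBall p →+* resField p := IsLocalRing.residue (unitBall p)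

theorem res_eq_zero_iff (x : unitBall p) : res p x = 0 ↔ ‖(x : ℂ_[p])‖ < 1 := by
  rw [IsLocalRing.residue_eq_zero_iff, IsLocalRing.mem_maximalIdeal, mem_nonunits_iff]
  have h1 : ‖(x : ℂ_[p])‖ ≤ 1 := mem_unitBall.1 x.2
  refine ⟨fun h => lt_of_le_of_ne h1 fun hx => h ?_, fun h hu => ?_⟩
  · have h0 : (x : ℂ_[p]) ≠ 0 := norm_ne_zero_iff.1 (by rw [hx]; exact one_ne_zero)
    have hm : (x : ℂ_[p])⁻¹ ∈ unitBall p := mem_unitBall.2 (by rw [norm_inv, hx, inv_one])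
    exact IsUnit.of_mul_eq_one ⟨_, hm⟩ (Subtype.ext (mul_inv_cancel₀ h0))
  · obtain ⟨y, hy⟩ := hu.exists_right_inv
    have e : ‖(x : ℂ_[p])‖ * ‖(y : ℂ_[p])‖ = 1 := by
      rw [← norm_mul]
      simpa using congrArg (fun t : unitBall p => ‖(t : ℂ_[p])‖) hy
    have := mul_lt_one_of_nonneg_of_lt_one_left (norm_nonneg _) h (mem_unitBall.1 y.2)
    exact this.ne e

theorem res_eq_res_iff (x y : unitBall p) : res p x = res p y ↔ ‖(x - y : ℂ_[p])‖ < 1 := by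
  rw [← sub_eq_zero, ← map_sub, res_eq_zero_iff]
  rfl

instance : CharP (resField p) p := by
  rw [CharP.charP_iff_prime_eq_zero (Fact.out : p.Prime)]
  have := (res_eq_zero_iff (p := p) (p : unitBall p)).2 (by simpa using norm_p_lt_one)
  simpa using this

/-- Raising integers to the power `p ^ n` is injective modulo the maximal ideal, because the
Frobenius of the residue field is. -/
theorem norm_pow_sub_pow_lt_one_iff {x y : ℂ_[p]} (hx : ‖x‖ ≤ 1) (hy : ‖y‖ ≤ 1) (n : ℕ) :
    ‖x ^ p ^ n - y ^ p ^ n‖ < 1 ↔ ‖x - y‖ < 1 := by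
  let X : unitBall p := ⟨x, mem_unitBall.2 hx⟩
  let Y : unitBall p := ⟨y, mem_unitBall.2 hy⟩
  have h1 := res_eq_res_iff (X ^ p ^ n) (Y ^ p ^ n)
  have h2 := res_eq_res_iff X Y
  rw [map_pow, map_pow, ← sub_eq_zero, ← sub_pow_char_pow,
    pow_eq_zero_iff (pow_ne_zero _ (Fact.out : p.Prime).ne_zero), sub_eq_zero] at h1
  exact h1.symm.trans h2

theorem norm_sub_one_lt_one_of_pow_eq_one {z : ℂ_[p]} {n : ℕ} (h : z ^ p ^ n = 1) :
    ‖z - 1‖ < 1 := by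
  have hz : ‖z‖ = 1 := by
    have : ‖z‖ ^ p ^ n = 1 := by rw [← norm_pow, h, norm_one]
    exact (pow_eq_one_iff_of_nonneg (norm_nonneg _)
      (pow_ne_zero _ (Fact.out : p.Prime).ne_zero)).1 this
  rw [← norm_pow_sub_pow_lt_one_iff hz.le norm_one.le n, h]
  simp

/-! ### Powers with exponents `p ^ n` -/

theorem norm_pow_p_sub_pow_p_le {x y : ℂ_[p]} (hx : ‖x‖ ≤ 1) (hy : ‖y‖ ≤ 1) :
    ‖x ^ p - y ^ p‖ ≤ max ‖(p : ℂ_[p])‖ ‖x - y‖ * ‖x - y‖ := by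
  have key : ‖∑ i ∈ Finset.range p, x ^ i * y ^ (p - 1 - i)‖ ≤ max ‖(p : ℂ_[p])‖ ‖x - y‖ := by
    have e : ∑ i ∈ Finset.range p, x ^ i * y ^ (p - 1 - i) =
        ∑ i ∈ Finset.range p, (x ^ i - y ^ i) * y ^ (p - 1 - i) + p * y ^ (p - 1) := by
      rw [← sub_eq_iff_eq_add', ← Finset.sum_sub_distrib]
      rw [Finset.sum_congr rfl (g := fun _ => y ^ (p - 1))]
      · simp
      · intro i hi
        have : i + (p - 1 - i) = p - 1 := by have := Finset.mem_range.1 hi; omega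
        rw [← sub_mul, sub_sub_cancel, ← pow_add, this]
    rw [e]
    refine (IsUltrametricDist.norm_add_le_max _ _).trans (max_le ?_ ?_)
    · refine IsUltrametricDist.norm_sum_le_of_forall_le_of_nonneg (by positivity) fun i _ => ?_
      refine le_trans ?_ (le_max_right _ _)
      rw [norm_mul, norm_pow, ← (Commute.all x y).mul_geom_sum₂ i, norm_mul, mul_assoc]
      refine mul_le_of_le_one_right (norm_nonneg _) (mul_le_one₀ ?_ (by positivity)
        (pow_le_one₀ (norm_nonneg _) hy))
      refine IsUltrametricDist.norm_sum_le_of_forall_le_of_nonneg zero_le_one fun j _ => ?_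
      rw [norm_mul, norm_pow, norm_pow]
      exact mul_le_one₀ (pow_le_one₀ (norm_nonneg _) hx) (by positivity)
        (pow_le_one₀ (norm_nonneg _) hy)
    · refine le_trans ?_ (le_max_left _ _)
      rw [norm_mul, norm_pow]
      exact mul_le_of_le_one_right (norm_nonneg _) (pow_le_one₀ (norm_nonneg _) hy)
  rw [← (Commute.all x y).geom_sum₂_mul p, norm_mul]
  exact mul_le_mul_of_nonneg_right key (norm_nonneg _)

/-- Congruent integers have `p ^ n`-th powers that approach each other. -/
theorem tendsto_pow_sub_pow {x y : ℂ_[p]} (hx : ‖x‖ ≤ 1) (hy : ‖y‖ ≤ 1) (h : ‖x - y‖ < 1) :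
    Tendsto (fun n : ℕ => x ^ p ^ n - y ^ p ^ n) atTop (𝓝 0) := by
  set κ := max ‖(p : ℂ_[p])‖ ‖x - y‖ with hκ
  have κ0 : 0 ≤ κ := le_trans (norm_nonneg _) (le_max_left _ _)
  have κ1 : κ < 1 := max_lt norm_p_lt_one h
  have key : ∀ n : ℕ, ‖x ^ p ^ n - y ^ p ^ n‖ ≤ κ ^ n * ‖x - y‖ := by
    intro n
    induction n with
    | zero => simp
    | succ n ih =>
      rw [pow_succ, pow_mul, pow_mul]
      refine (norm_pow_p_sub_pow_p_le (by simpa using pow_le_one₀ (norm_nonneg _) hx)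
        (by simpa using pow_le_one₀ (norm_nonneg _) hy)).trans ?_
      rw [pow_succ', mul_assoc]
      refine mul_le_mul (max_le_max le_rfl (ih.trans ?_)) ih (norm_nonneg _) κ0
      exact mul_le_of_le_one_left (norm_nonneg _) (pow_le_one₀ κ0 κ1.le)
  refine squeeze_zero_norm key ?_
  simpa using (tendsto_pow_atTop_nhds_zero_of_lt_one κ0 κ1).mul_const ‖x - y‖

theorem tendsto_p_pow : Tendsto (fun n : ℕ => p ^ n) atTop atTop :=
  tendsto_pow_atTop_atTop_of_one_lt (Fact.out : p.Prime).one_lt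

/-- Some power `u ^ p ^ i` recurs modulo the maximal ideal. An element of `PadicAlgCl p` that is
congruent to `u` generates a finite extension of `ℚ_[p]`, whose unit ball is compact. -/
theorem exists_norm_pow_sub_pow_lt_one {u : ℂ_[p]} (hu : ‖u‖ ≤ 1) :
    ∃ l : ℕ, 0 < l ∧ ‖u ^ p ^ l - u‖ < 1 := by
  obtain ⟨w, hw⟩ := Metric.denseRange_iff.1
    (UniformSpace.Completion.denseRange_coe (α := PadicAlgCl p)) u 1 one_pos
  rw [dist_eq_norm] at hw
  have hw1 : ‖w‖ ≤ 1 := by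
    rw [← PadicComplex.norm_extends]
    have := norm_sub_le_max u (u - (w : ℂ_[p]))
    rw [sub_sub_cancel] at this
    exact this.trans (max_le hu hw.le)
  obtain ⟨i, j, hij, hd⟩ : ∃ i j : ℕ, i < j ∧ ‖w ^ p ^ j - w ^ p ^ i‖ < 1 := by
    let E := IntermediateField.adjoin ℚ_[p] {w}
    have : FiniteDimensional ℚ_[p] E :=
      IntermediateField.adjoin.finiteDimensional (Algebra.IsIntegral.isIntegral w)
    have : ProperSpace E := FiniteDimensional.proper ℚ_[p] E
    let v : E := ⟨w, IntermediateField.mem_adjoin_simple_self _ _⟩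
    obtain ⟨x, -, φ, hφ, hx⟩ := tendsto_subseq_of_bounded (s := Metric.closedBall (0 : E) 1)
      Metric.isBounded_closedBall (x := fun n => v ^ p ^ n) (fun n => by
        rw [mem_closedBall_zero_iff, norm_pow]
        exact pow_le_one₀ (norm_nonneg _) hw1)
    obtain ⟨N, hN⟩ := Metric.cauchySeq_iff.1 hx.cauchySeq 1 one_pos
    refine ⟨φ N, φ (N + 1), hφ (Nat.lt_succ_self N), ?_⟩
    have := hN (N + 1) (by omega) N le_rfl
    rwa [dist_eq_norm] at this
  have hwc : ‖(w : ℂ_[p])‖ ≤ 1 := by rwa [PadicComplex.norm_extends]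
  have hd' : ‖(w : ℂ_[p]) ^ p ^ j - (w : ℂ_[p]) ^ p ^ i‖ < 1 := by
    rw [PadicComplex.coe_eq, ← map_pow, ← map_pow, ← map_sub, ← PadicComplex.coe_eq,
      PadicComplex.norm_extends]
    exact hd
  refine ⟨j - i, by omega, ?_⟩
  have e1 : (w : ℂ_[p]) ^ p ^ j = ((w : ℂ_[p]) ^ p ^ (j - i)) ^ p ^ i := by
    rw [← pow_mul, ← pow_add, Nat.sub_add_cancel hij.le]
  rw [e1, norm_pow_sub_pow_lt_one_iff (by simpa using pow_le_one₀ (norm_nonneg _) hwc) hwc] at hd'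
  have h1 := (norm_pow_sub_pow_lt_one_iff hu hwc (j - i)).2 hw
  have e2 : u ^ p ^ (j - i) - u = (u ^ p ^ (j - i) - (w : ℂ_[p]) ^ p ^ (j - i)) +
      ((w : ℂ_[p]) ^ p ^ (j - i) - w) + (w - u) := by ring
  rw [e2]
  refine (IsUltrametricDist.norm_add_le_max _ _).trans_lt (max_lt
    ((IsUltrametricDist.norm_add_le_max _ _).trans_lt (max_lt h1 hd')) ?_)
  rwa [norm_sub_rev]

/-! ### Integrals with respect to `Φ_α` as limits along a filter -/

/-- The filter generated by the tails of the sequences in `Φ_α`. -/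
def linFilter (α : ℕ) : Filter ℕ where
  sets := {S | ∃ l, 0 < l ∧ ∃ K, ∀ k, K < k → α + l * k ∈ S}
  univ_sets := ⟨1, one_pos, 0, fun _ _ => trivial⟩
  sets_of_superset := by
    rintro S T ⟨l, hl, K, h⟩ hST
    exact ⟨l, hl, K, fun k hk => hST (h k hk)⟩
  inter_sets := by
    rintro S T ⟨l, hl, K, h⟩ ⟨l', hl', K', h'⟩
    refine ⟨l * l', Nat.mul_pos hl hl', max K K', fun k hk => ⟨?_, ?_⟩⟩
    · rw [mul_assoc]
      exact h _ ((le_max_left K K').trans_lt (hk.trans_le (Nat.le_mul_of_pos_left k hl')))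
    · rw [mul_comm l, mul_assoc]
      exact h' _ ((le_max_right K K').trans_lt (hk.trans_le (Nat.le_mul_of_pos_left k hl)))

theorem mem_linFilter {α : ℕ} {S : Set ℕ} :
    S ∈ linFilter α ↔ ∃ l, 0 < l ∧ ∃ K, ∀ k, K < k → α + l * k ∈ S := Iff.rfl

instance (α : ℕ) : (linFilter α).NeBot := by
  refine neBot_iff.2 fun h => ?_
  obtain ⟨l, -, K, hK⟩ := mem_linFilter.1 (h ▸ mem_bot : (∅ : Set ℕ) ∈ linFilter α)
  exact hK (K + 1) (Nat.lt_succ_self K)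

theorem linFilter_le_atTop (α : ℕ) : linFilter α ≤ atTop := by
  refine atTop_basis.ge_iff.2 fun n _ => mem_linFilter.2 ⟨1, one_pos, n, fun k hk => ?_⟩
  simp only [Set.mem_Ici]
  omega

theorem linFilter_le_map (α : ℕ) {l : ℕ} (hl : 0 < l) :
    linFilter α ≤ map (fun k => α + l * k) atTop := by
  intro S hS
  obtain ⟨K, hK⟩ := mem_atTop_sets.1 (mem_map.1 hS)
  exact ⟨l, hl, K, fun k hk => hK k hk.le⟩

theorem hasArcIntegral_iff {α : ℕ} {a b L : ℂ_[p]} {f : ℂ_[p] → ℂ_[p]} :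
    HasArcIntegral (linFamily α) a b f L ↔ Tendsto (arcMean a b f) (linFilter α) (𝓝 L) := by
  rw [Metric.tendsto_nhds]
  refine forall₂_congr fun ε _ => ?_
  simp only [dist_eq_norm]
  constructor
  · rintro ⟨φ, ⟨l, hl, e⟩, K, h⟩
    exact ⟨l, hl, K, fun k hk => by simpa [e] using h k hk⟩
  · rintro ⟨l, hl, K, h⟩
    exact ⟨fun k => α + l * k, ⟨l, hl, fun _ => rfl⟩, K, h⟩

/-- For an integer `u` the powers `u ^ p ^ n` converge along `Φ_α`: with `l` such that
`u ^ p ^ l` is congruent to `u`, consecutive terms of `u ^ p ^ (α + l * k)` approach each other. -/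
theorem exists_tendsto_pow (α : ℕ) {u : ℂ_[p]} (hu : ‖u‖ ≤ 1) :
    ∃ τ : ℂ_[p], Tendsto (fun n : ℕ => u ^ p ^ n) (linFilter α) (𝓝 τ) := by
  obtain ⟨l, hl, h⟩ := exists_norm_pow_sub_pow_lt_one hu
  have hul : ‖u ^ p ^ l‖ ≤ 1 := by simpa using pow_le_one₀ (norm_nonneg _) hu
  have ht : Tendsto (fun k : ℕ => α + l * k) atTop atTop :=
    tendsto_atTop_mono (fun k => (Nat.le_mul_of_pos_left k hl).trans (Nat.le_add_left _ α))
      tendsto_id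
  have hc : CauchySeq (fun k : ℕ => u ^ p ^ (α + l * k)) := by
    refine NonarchimedeanAddGroup.cauchySeq_of_tendsto_sub_nhds_zero
      (((tendsto_pow_sub_pow hul hu h).comp ht).congr fun k => ?_)
    simp only [Function.comp]
    rw [← pow_mul, ← pow_add, mul_add, mul_one]
    congr 3
    omega
  obtain ⟨τ, hτ⟩ := cauchySeq_tendsto_of_complete hc
  exact ⟨τ, Tendsto.mono_left (tendsto_map'_iff (f := fun n : ℕ => u ^ p ^ n).2 hτ)
    (linFilter_le_map α hl)⟩

/-! ### Means of powers and of simple poles -/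

theorem pow_p_pos (n : ℕ) : 0 < p ^ n := pow_pos (Fact.out : p.Prime).pos n

theorem pow_p_ne_zero (n : ℕ) : ((p : ℂ_[p]) ^ n) ≠ 0 :=
  pow_ne_zero _ (Nat.cast_ne_zero.2 (Fact.out : p.Prime).ne_zero)

theorem sum_nthRoots_pow {N : ℕ} (hN : 0 < N) (j : ℕ) :
    ∑ ζ ∈ Polynomial.nthRootsFinset N (1 : ℂ_[p]), ζ ^ j = if N ∣ j then (N : ℂ_[p]) else 0 := by
  have : NeZero N := ⟨hN.ne'⟩
  obtain ⟨g, hg⟩ := HasEnoughRootsOfUnity.exists_primitiveRoot ℂ_[p] N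
  split_ifs with h
  · obtain ⟨i, rfl⟩ := h
    rw [Finset.sum_congr rfl (g := fun _ => (1 : ℂ_[p]))]
    · simp [hg.card_nthRootsFinset]
    · intro ζ hζ
      rw [pow_mul, (Polynomial.mem_nthRootsFinset hN 1).1 hζ, one_pow]
  · -- multiplication by a primitive root permutes the roots and multiplies the sum by `g ^ j ≠ 1`
    have hgj : g ^ j ≠ 1 := fun e => h (hg.dvd_of_pow_eq_one j e)
    have hg0 : g ≠ 0 := hg.ne_zero hN.ne'
    have e : ∑ ζ ∈ Polynomial.nthRootsFinset N (1 : ℂ_[p]), ζ ^ j =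
        g ^ j * ∑ ζ ∈ Polynomial.nthRootsFinset N (1 : ℂ_[p]), ζ ^ j := by
      rw [Finset.mul_sum]
      refine Finset.sum_bij' (fun ζ _ => g⁻¹ * ζ) (fun ζ _ => g * ζ) ?_ ?_ ?_ ?_ ?_
      · intro ζ hζ
        rw [Polynomial.mem_nthRootsFinset hN] at hζ ⊢
        rw [mul_pow, inv_pow, hg.pow_eq_one, hζ, inv_one, one_mul]
      · intro ζ hζ
        rw [Polynomial.mem_nthRootsFinset hN] at hζ ⊢
        rw [mul_pow, hg.pow_eq_one, hζ, one_mul]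
      · intro ζ _
        exact mul_inv_cancel_left₀ hg0 ζ
      · intro ζ _
        exact inv_mul_cancel_left₀ hg0 ζ
      · intro ζ _
        rw [← mul_pow, mul_inv_cancel_left₀ hg0]
    have e' : (g ^ j - 1) * ∑ ζ ∈ Polynomial.nthRootsFinset N (1 : ℂ_[p]), ζ ^ j = 0 := by
      rw [sub_mul, one_mul, ← e, sub_self]
    exact (mul_eq_zero.1 e').resolve_left (sub_ne_zero.2 hgj)

theorem arcMean_add (a b : ℂ_[p]) (f g : ℂ_[p] → ℂ_[p]) (n : ℕ) :
    arcMean a b (f + g) n = arcMean a b f n + arcMean a b g n := by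
  simp only [arcMean, Pi.add_apply, mul_add, Finset.sum_add_distrib]

theorem arcMean_smul (a b : ℂ_[p]) (k : ℂ_[p]) (f : ℂ_[p] → ℂ_[p]) (n : ℕ) :
    arcMean a b (k • f) n = k * arcMean a b f n := by
  simp only [arcMean, Pi.smul_apply, smul_eq_mul, Finset.mul_sum]
  exact Finset.sum_congr rfl fun ζ _ => by ring

theorem arcMean_zero (a b : ℂ_[p]) (n : ℕ) : arcMean a b 0 n = 0 := by
  simp [arcMean]

theorem arcMean_sub (a b : ℂ_[p]) (f g : ℂ_[p] → ℂ_[p]) (n : ℕ) :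
    arcMean a b (f - g) n = arcMean a b f n - arcMean a b g n := by
  rw [sub_eq_add_neg, arcMean_add, ← neg_one_smul ℂ_[p] g, arcMean_smul, neg_one_mul,
    sub_eq_add_neg]

theorem arcMean_pow_eq_zero (a b : ℂ_[p]) {k n : ℕ} (h : k + 1 < p ^ n) :
    arcMean a b (fun z => z ^ k) n = 0 := by
  unfold arcMean
  have e : ∀ ζ : ℂ_[p], (a + (b - a) * ζ - a) * (a + (b - a) * ζ) ^ k =
      ∑ i ∈ Finset.range (k + 1),
        ((b - a) ^ (i + 1) * a ^ (k - i) * (k.choose i)) * ζ ^ (i + 1) := by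
    intro ζ
    rw [add_comm a, add_pow, Finset.mul_sum]
    exact Finset.sum_congr rfl fun i _ => by rw [mul_pow]; ring
  simp only [e]
  rw [Finset.sum_comm, Finset.sum_eq_zero, mul_zero]
  intro i hi
  rw [← Finset.mul_sum, sum_nthRoots_pow (pow_p_pos n), if_neg, mul_zero]
  intro hd
  have := Nat.le_of_dvd (Nat.succ_pos i) hd
  have := Finset.mem_range.1 hi
  omega

theorem tendsto_arcMean_pow (a b : ℂ_[p]) (k : ℕ) :
    Tendsto (arcMean a b (fun z => z ^ k)) atTop (𝓝 0) := by
  refine tendsto_const_nhds.congr' ?_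
  filter_upwards [(tendsto_p_pow (p := p)).eventually (eventually_gt_atTop (k + 1))] with n hn
  exact (arcMean_pow_eq_zero a b hn).symm

theorem pow_ne_one_of_one_le {u : ℂ_[p]} (hu : 1 ≤ ‖u - 1‖) (n : ℕ) : u ^ p ^ n ≠ 1 :=
  fun h => (norm_sub_one_lt_one_of_pow_eq_one h).not_ge hu

theorem one_le_norm_pole {a b c : ℂ_[p]} (hab : a ≠ b) (hc : c ∉ arc a b) :
    1 ≤ ‖(c - a) / (b - a) - 1‖ := by
  have hd : b - a ≠ 0 := sub_ne_zero.2 hab.symm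
  have e : (c - a) / (b - a) - 1 = (c - b) / (b - a) := by field_simp; ring
  rw [e, norm_div, one_le_div (norm_pos_iff.2 hd)]
  rw [arc, Metric.mem_ball, dist_eq_norm, not_lt] at hc
  exact hc

theorem arcMean_inv_sub {a b c : ℂ_[p]} (hab : a ≠ b) (hc : c ∉ arc a b) (n : ℕ) :
    arcMean a b (fun z => (z - c)⁻¹) n = (1 - ((c - a) / (b - a)) ^ p ^ n)⁻¹ := by
  have hd : b - a ≠ 0 := sub_ne_zero.2 hab.symm
  set u := (c - a) / (b - a) with hu
  have hu1 : u ^ p ^ n ≠ 1 := pow_ne_one_of_one_le (one_le_norm_pole hab hc) n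
  have h1 : (1 - u ^ p ^ n) ≠ 0 := sub_ne_zero.2 hu1.symm
  have hcu : c = a + (b - a) * u := by rw [hu]; field_simp; ring
  have e : ∀ ζ ∈ Polynomial.nthRootsFinset (p ^ n) (1 : ℂ_[p]),
      (a + (b - a) * ζ - a) * (a + (b - a) * ζ - c)⁻¹ =
        (1 - u ^ p ^ n)⁻¹ * ∑ i ∈ Finset.range (p ^ n), u ^ (p ^ n - 1 - i) * ζ ^ (i + 1) := by
    intro ζ hζ
    rw [Polynomial.mem_nthRootsFinset (pow_p_pos n)] at hζ
    have hζu : ζ - u ≠ 0 := fun h => hu1 (by rw [← sub_eq_zero.1 h, hζ])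
    have hs : (∑ i ∈ Finset.range (p ^ n), u ^ (p ^ n - 1 - i) * ζ ^ (i + 1)) =
        ζ * ∑ i ∈ Finset.range (p ^ n), ζ ^ i * u ^ (p ^ n - 1 - i) := by
      rw [Finset.mul_sum]
      exact Finset.sum_congr rfl fun i _ => by ring
    have hg := (Commute.all ζ u).geom_sum₂_mul (p ^ n)
    rw [hζ] at hg
    rw [hs, hcu, show a + (b - a) * ζ - a = (b - a) * ζ by ring,
      show a + (b - a) * ζ - (a + (b - a) * u) = (b - a) * (ζ - u) by ring, ← hg]
    have : (∑ i ∈ Finset.range (p ^ n), ζ ^ i * u ^ (p ^ n - 1 - i)) ≠ 0 := fun h => by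
      rw [h, zero_mul] at hg
      exact h1 hg.symm
    field_simp
  rw [arcMean, Finset.sum_congr rfl e, ← Finset.mul_sum, Finset.sum_comm]
  -- only the exponent `p ^ n` is divisible by `p ^ n`
  rw [Finset.sum_eq_single (p ^ n - 1)]
  · rw [← Finset.mul_sum, Nat.sub_add_cancel (pow_p_pos n), sum_nthRoots_pow (pow_p_pos n),
      if_pos dvd_rfl, Nat.sub_self, pow_zero, one_mul, Nat.cast_pow, mul_comm _⁻¹ ((p : ℂ_[p]) ^ n),
      inv_mul_cancel_left₀ (pow_p_ne_zero n)]
  · intro i hi hne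
    rw [← Finset.mul_sum, sum_nthRoots_pow (pow_p_pos n), if_neg, mul_zero]
    intro hd
    have := Nat.le_of_dvd (Nat.succ_pos i) hd
    have := Finset.mem_range.1 hi
    omega
  · intro h
    exact absurd (Finset.mem_range.2 (Nat.sub_lt (pow_p_pos n) one_pos)) h

/-! ### Limits of the weights `(1 - u ^ p ^ n)⁻¹` -/

theorem one_le_norm_one_sub_pow {u : ℂ_[p]} (hu : ‖u‖ ≤ 1) (h : 1 ≤ ‖u - 1‖) (n : ℕ) :
    1 ≤ ‖1 - u ^ p ^ n‖ := by
  have := (norm_pow_sub_pow_lt_one_iff hu norm_one.le n).not.2 h.not_gt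
  rw [one_pow, norm_sub_rev] at this
  exact not_lt.1 this

theorem norm_one_sub_pow_of_one_lt {u : ℂ_[p]} (hu : 1 < ‖u‖) (n : ℕ) :
    ‖1 - u ^ p ^ n‖ = ‖u‖ ^ p ^ n := by
  have h1 : 1 < ‖u ^ p ^ n‖ := by
    rw [norm_pow]
    exact one_lt_pow₀ hu (pow_p_pos n).ne'
  rw [norm_sub_rev, ← norm_pow]
  refine norm_eq_of_norm_sub_lt ?_
  rw [sub_sub_cancel_left, norm_neg, norm_one]
  exact h1

theorem tendsto_weight_zero {u : ℂ_[p]} (hu : 1 < ‖u‖) :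
    Tendsto (fun n : ℕ => (1 - u ^ p ^ n)⁻¹) atTop (𝓝 0) := by
  rw [tendsto_zero_iff_norm_tendsto_zero]
  have : Tendsto (fun n : ℕ => (‖u‖ ^ p ^ n)⁻¹) atTop (𝓝 0) :=
    ((tendsto_pow_atTop_atTop_of_one_lt hu).comp tendsto_p_pow).inv_tendsto_atTop
  refine this.congr fun n => ?_
  rw [norm_inv, norm_one_sub_pow_of_one_lt hu]

theorem exists_tendsto_weight (α : ℕ) {u : ℂ_[p]} (h : 1 ≤ ‖u - 1‖) :
    ∃ w : ℂ_[p], Tendsto (fun n : ℕ => (1 - u ^ p ^ n)⁻¹) (linFilter α) (𝓝 w) := by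
  rcases le_or_gt ‖u‖ 1 with hu | hu
  · obtain ⟨τ, hτ⟩ := exists_tendsto_pow α hu
    have ht := hτ.const_sub 1
    refine ⟨(1 - τ)⁻¹, ht.inv₀ fun h0 => ?_⟩
    have : 1 ≤ ‖1 - τ‖ :=
      ge_of_tendsto' ht.norm fun n => one_le_norm_one_sub_pow hu h n
    rw [h0, norm_zero] at this
    exact absurd this zero_lt_one.not_ge
  · exact ⟨0, (tendsto_weight_zero hu).mono_left (linFilter_le_atTop α)⟩

theorem tendsto_weight_sub {u v : ℂ_[p]} (hu : 1 ≤ ‖u - 1‖) (hv : 1 ≤ ‖v - 1‖)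
    (h : ‖u - v‖ < 1 ∨ 1 < ‖u‖ ∧ 1 < ‖v‖) :
    Tendsto (fun n : ℕ => (1 - u ^ p ^ n)⁻¹ - (1 - v ^ p ^ n)⁻¹) atTop (𝓝 0) := by
  have big : 1 < ‖u‖ → 1 < ‖v‖ →
      Tendsto (fun n : ℕ => (1 - u ^ p ^ n)⁻¹ - (1 - v ^ p ^ n)⁻¹) atTop (𝓝 0) := fun a b => by
    simpa using (tendsto_weight_zero a).sub (tendsto_weight_zero b)
  rcases h with h | h
  · rcases le_or_gt ‖v‖ 1 with h1 | h1
    · have h2 : ‖u‖ ≤ 1 := by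
        rw [← sub_add_cancel u v]
        exact (IsUltrametricDist.norm_add_le_max _ _).trans (max_le h.le h1)
      refine squeeze_zero_norm (fun n => ?_) (norm_zero (E := ℂ_[p]) ▸ (tendsto_pow_sub_pow h2 h1 h).norm)
      have k1 := one_le_norm_one_sub_pow h2 hu n
      have k2 := one_le_norm_one_sub_pow h1 hv n
      have n1 : 1 - u ^ p ^ n ≠ 0 := norm_pos_iff.1 (zero_lt_one.trans_le k1)
      have n2 : 1 - v ^ p ^ n ≠ 0 := norm_pos_iff.1 (zero_lt_one.trans_le k2)
      rw [inv_sub_inv n1 n2, norm_div, norm_mul, sub_sub_sub_cancel_left]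
      exact div_le_self (norm_nonneg _) (one_le_mul_of_one_le_of_one_le k1 k2)
    · have h2 : ‖u‖ = ‖v‖ := norm_eq_of_norm_sub_lt (h.trans h1)
      exact big (h2 ▸ h1) h1
  · exact big h.1 h.2

/-! ### Bounded power series on an open disc -/

/-- `g (b + T)` is given, for `‖T‖ < s`, by the power series with coefficients `c`, and these
satisfy `‖c k‖ * s ^ k = O(1)`. -/
structure HasBddSeries (c : ℕ → ℂ_[p]) (b : ℂ_[p]) (s : ℝ) (g : ℂ_[p] → ℂ_[p]) : Prop where
  bdd : ∃ C : ℝ, ∀ k, ‖c k‖ * s ^ k ≤ C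
  hasSum : ∀ T : ℂ_[p], ‖T‖ < s → HasSum (fun k => c k * T ^ k) (g (b + T))

namespace HasBddSeries

theorem zero (b : ℂ_[p]) (s : ℝ) : HasBddSeries 0 b s 0 where
  bdd := ⟨0, fun k => by simp⟩
  hasSum := fun T _ => by simp

theorem add {c c' : ℕ → ℂ_[p]} {b : ℂ_[p]} {s : ℝ} (hs : 0 ≤ s) {g g' : ℂ_[p] → ℂ_[p]}
    (h : HasBddSeries c b s g) (h' : HasBddSeries c' b s g') :
    HasBddSeries (c + c') b s (g + g') where
  bdd := by
    obtain ⟨C, hC⟩ := h.bdd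
    obtain ⟨C', hC'⟩ := h'.bdd
    refine ⟨C + C', fun k => ?_⟩
    refine (mul_le_mul_of_nonneg_right (norm_add_le _ _) (pow_nonneg hs k)).trans ?_
    rw [add_mul]
    exact add_le_add (hC k) (hC' k)
  hasSum := fun T hT => by
    simpa [add_mul] using (h.hasSum T hT).add (h'.hasSum T hT)

theorem smul {c : ℕ → ℂ_[p]} {b : ℂ_[p]} {s : ℝ} {g : ℂ_[p] → ℂ_[p]} (a : ℂ_[p])
    (h : HasBddSeries c b s g) : HasBddSeries (a • c) b s (a • g) where
  bdd := by
    obtain ⟨C, hC⟩ := h.bdd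
    refine ⟨‖a‖ * C, fun k => ?_⟩
    rw [Pi.smul_apply, norm_smul, mul_assoc]
    exact mul_le_mul_of_nonneg_left (hC k) (norm_nonneg a)
  hasSum := fun T hT => by
    simpa [mul_assoc] using (h.hasSum T hT).mul_left a

theorem pow (b : ℂ_[p]) {s : ℝ} (hs : 0 ≤ s) (k : ℕ) :
    HasBddSeries (fun i => b ^ (k - i) * (k.choose i : ℂ_[p])) b s (fun z => z ^ k) where
  bdd := by
    refine ⟨∑ i ∈ Finset.range (k + 1), ‖b ^ (k - i) * (k.choose i : ℂ_[p])‖ * s ^ i,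
      fun i => ?_⟩
    rcases lt_or_ge i (k + 1) with h | h
    · exact Finset.single_le_sum
        (f := fun i => ‖b ^ (k - i) * (k.choose i : ℂ_[p])‖ * s ^ i)
        (fun i _ => mul_nonneg (norm_nonneg _) (pow_nonneg hs i)) (Finset.mem_range.2 h)
    · rw [Nat.choose_eq_zero_of_lt h, Nat.cast_zero, mul_zero, norm_zero, zero_mul]
      exact Finset.sum_nonneg fun i _ => mul_nonneg (norm_nonneg _) (pow_nonneg hs i)
  hasSum := fun T _ => by
    have e : (b + T) ^ k =
        ∑ i ∈ Finset.range (k + 1), b ^ (k - i) * (k.choose i : ℂ_[p]) * T ^ i := by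
      rw [add_comm, add_pow]
      exact Finset.sum_congr rfl fun i _ => by ring
    rw [e]
    refine hasSum_sum_of_ne_finset_zero fun i hi => ?_
    rw [Finset.mem_range, not_lt] at hi
    rw [Nat.choose_eq_zero_of_lt hi, Nat.cast_zero, mul_zero, zero_mul]

theorem inv_sub {b c : ℂ_[p]} {s : ℝ} (hs : 0 < s) (hc : s ≤ ‖c - b‖) :
    HasBddSeries (fun i => -(c - b)⁻¹ * ((c - b)⁻¹) ^ i) b s (fun z => (z - c)⁻¹) where
  bdd := by
    refine ⟨‖(c - b)⁻¹‖, fun k => ?_⟩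
    rw [norm_mul, norm_neg, mul_assoc, norm_pow, ← mul_pow]
    refine mul_le_of_le_one_right (norm_nonneg _) (pow_le_one₀ (by positivity) ?_)
    rw [norm_inv, inv_mul_le_one₀ (hs.trans_le hc)]
    exact hc
  hasSum := fun T hT => by
    have h0 : c - b ≠ 0 := norm_pos_iff.1 (hs.trans_le hc)
    have h1 : ‖(c - b)⁻¹ * T‖ < 1 := by
      rw [norm_mul, norm_inv, inv_mul_lt_one₀ (hs.trans_le hc)]
      exact hT.trans_le hc
    have := (hasSum_geometric_of_norm_lt_one h1).mul_left (-(c - b)⁻¹)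
    simp only [mul_pow, ← mul_assoc] at this
    have e : (b + T - c)⁻¹ = -(c - b)⁻¹ * (1 - (c - b)⁻¹ * T)⁻¹ := by
      rw [neg_mul, ← mul_inv, ← inv_neg, mul_sub, mul_one, mul_inv_cancel_left₀ h0]
      congr 1
      ring
    rw [e]
    exact this

end HasBddSeries

/-- Cauchy's estimate for polynomials, by averaging over roots of unity of an order that is a unit
of the ring of integers. -/
theorem norm_coeff_mul_pow_le {c : ℕ → ℂ_[p]} {t : ℂ_[p]} {ε : ℝ} {m : ℕ}
    (h : ∀ T : ℂ_[p], ‖T‖ = ‖t‖ → ‖∑ i ∈ Finset.range m, c i * T ^ i‖ ≤ ε) {k : ℕ} (hk : k < m) :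
    ‖c k * t ^ k‖ ≤ ε := by
  set N := p * m + 1 with hN
  have hp1 : 1 ≤ p := (Fact.out : p.Prime).one_le
  have hmN : m < N := by nlinarith
  have hN0 : 0 < N := Nat.succ_pos _
  have hNn : ‖(N : ℂ_[p])‖ = 1 := by
    have : ‖(N : ℂ_[p]) - 1‖ < ‖(1 : ℂ_[p])‖ := by
      rw [hN, Nat.cast_add, Nat.cast_one, add_sub_cancel_right, Nat.cast_mul, norm_mul, norm_one]
      exact mul_lt_one_of_nonneg_of_lt_one_left (norm_nonneg _) norm_p_lt_one
        (norm_natCast_le_one m)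
    rw [norm_eq_of_norm_sub_lt this, norm_one]
  have hε : 0 ≤ ε := (norm_nonneg _).trans (h t rfl)
  have e : ∑ η ∈ Polynomial.nthRootsFinset N (1 : ℂ_[p]),
      η ^ (N - k) * ∑ i ∈ Finset.range m, c i * (t * η) ^ i = N * (c k * t ^ k) := by
    simp only [Finset.mul_sum]
    rw [Finset.sum_comm, Finset.sum_eq_single k]
    · rw [Finset.sum_congr rfl (g := fun η => c k * t ^ k * η ^ N)]
      · rw [← Finset.mul_sum, sum_nthRoots_pow hN0, if_pos dvd_rfl, mul_comm]
      · intro η _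
        rw [show η ^ N = η ^ (N - k) * η ^ k by rw [← pow_add, Nat.sub_add_cancel (by omega)]]
        ring
    · intro i hi hik
      rw [Finset.sum_congr rfl (g := fun η => c i * t ^ i * η ^ (N - k + i))]
      · rw [← Finset.mul_sum, sum_nthRoots_pow hN0, if_neg, mul_zero]
        rintro ⟨q, hq⟩
        have := Finset.mem_range.1 hi
        rcases q with _ | _ | q
        · omega
        · omega
        · have : N * 2 ≤ N * (q + 1 + 1) := Nat.mul_le_mul_left _ (by omega)
          omega
      · intro η _
        rw [mul_pow, pow_add]
        ring
    · intro hk'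
      exact absurd (Finset.mem_range.2 hk) hk'
  have e2 : ‖c k * t ^ k‖ = ‖(N : ℂ_[p]) * (c k * t ^ k)‖ := by
    rw [norm_mul (N : ℂ_[p]), hNn, one_mul]
  rw [e2, ← e]
  refine IsUltrametricDist.norm_sum_le_of_forall_le_of_nonneg hε fun η hη => ?_
  have hη1 : ‖η‖ = 1 := by
    have : ‖η‖ ^ N = 1 := by
      rw [← norm_pow, (Polynomial.mem_nthRootsFinset hN0 1).1 hη, norm_one]
    exact (pow_eq_one_iff_of_nonneg (norm_nonneg _) hN0.ne').1 this
  rw [norm_mul, norm_pow, hη1, one_pow, one_mul]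
  exact h _ (by rw [norm_mul, hη1, mul_one])

namespace HasBddSeries

/-- Cauchy's estimate on a smaller circle: the tail of the series is small there, so that the
estimate for polynomials applies. -/
theorem norm_coeff_mul_pow_le {c : ℕ → ℂ_[p]} {b : ℂ_[p]} {s : ℝ} {g : ℂ_[p] → ℂ_[p]}
    (h : HasBddSeries c b s g) {ε : ℝ} (hε : 0 < ε) (hg : ∀ T : ℂ_[p], ‖T‖ < s → ‖g (b + T)‖ ≤ ε)
    {t : ℂ_[p]} (ht : ‖t‖ < s) (k : ℕ) : ‖c k * t ^ k‖ ≤ ε := by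
  have hz : Tendsto (fun i => ‖c i * t ^ i‖) atTop (𝓝 0) := by
    simpa using (h.hasSum t ht).summable.tendsto_atTop_zero.norm
  obtain ⟨m, hm⟩ := eventually_atTop.1 (hz.eventually (eventually_le_nhds hε))
  refine PadicArc.norm_coeff_mul_pow_le (m := max m (k + 1)) (fun T hT => ?_)
    (lt_of_lt_of_le (Nat.lt_succ_self k) (le_max_right _ _))
  have hTs : ‖T‖ < s := hT ▸ ht
  have htail : ‖g (b + T) - ∑ i ∈ Finset.range (max m (k + 1)), c i * T ^ i‖ ≤ ε := by
    have hl := ((h.hasSum T hTs).tendsto_sum_nat.sub_const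
      (∑ i ∈ Finset.range (max m (k + 1)), c i * T ^ i)).norm
    refine le_of_tendsto hl (eventually_atTop.2 ⟨max m (k + 1), fun n hn => ?_⟩)
    rw [← Finset.sum_Ico_eq_sub _ hn]
    refine IsUltrametricDist.norm_sum_le_of_forall_le_of_nonneg hε.le fun i hi => ?_
    have := hm i ((le_max_left _ _).trans (Finset.mem_Ico.1 hi).1)
    rwa [norm_mul, norm_pow, hT, ← norm_pow, ← norm_mul]
  rw [← sub_sub_cancel (g (b + T)) (∑ i ∈ Finset.range (max m (k + 1)), c i * T ^ i)]
  exact (norm_sub_le_max _ _).trans (max_le (hg T hTs) htail)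

/-- Cauchy's estimate on the open disc. The circles used have the radii `‖d‖ * ‖p‖ ^ (1 / j)`. -/
theorem norm_coeff_le {c : ℕ → ℂ_[p]} {b d : ℂ_[p]} (hd : d ≠ 0) {g : ℂ_[p] → ℂ_[p]}
    (h : HasBddSeries c b ‖d‖ g) {ε : ℝ} (hε : 0 < ε)
    (hg : ∀ T : ℂ_[p], ‖T‖ < ‖d‖ → ‖g (b + T)‖ ≤ ε) (k : ℕ) : ‖c k * d ^ k‖ ≤ ε := by
  have hp0 : 0 < ‖(p : ℂ_[p])‖ :=
    norm_pos_iff.2 (Nat.cast_ne_zero.2 (Fact.out : p.Prime).ne_zero)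
  have key : ∀ j : ℕ, 0 < j → (‖c k * d ^ k‖ / ε) ^ j ≤ (‖(p : ℂ_[p])‖ ^ k)⁻¹ := by
    intro j hj
    obtain ⟨π, hπ⟩ := IsAlgClosed.exists_pow_nat_eq (p : ℂ_[p]) hj
    have hπ' : ‖π‖ ^ j = ‖(p : ℂ_[p])‖ := by rw [← norm_pow, hπ]
    have hπ1 : ‖π‖ < 1 := by
      by_contra! hn
      exact (one_le_pow₀ hn (n := j)).not_gt (hπ' ▸ norm_p_lt_one)
    have hlt : ‖d * π‖ < ‖d‖ := by
      rw [norm_mul]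
      exact mul_lt_of_lt_one_right (norm_pos_iff.2 hd) hπ1
    have := pow_le_pow_left₀ (norm_nonneg _) (h.norm_coeff_mul_pow_le hε hg hlt k) j
    rw [mul_pow, ← mul_assoc, norm_mul, mul_pow, norm_pow π, ← pow_mul, mul_comm k j, pow_mul,
      hπ'] at this
    rw [div_pow, div_le_iff₀ (pow_pos hε j), inv_mul_eq_div, le_div_iff₀ (pow_pos hp0 k)]
    exact this
  by_contra! hn
  obtain ⟨j, hj, hj'⟩ := (((tendsto_pow_atTop_atTop_of_one_lt ((one_lt_div hε).2 hn)).eventually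
    (eventually_gt_atTop (‖(p : ℂ_[p])‖ ^ k)⁻¹)).and (eventually_gt_atTop 0)).exists
  exact (key j hj').not_gt hj

end HasBddSeries

/-- `p ^ (-n) * ∑ ζ * (ζ - 1) ^ k` is an integer. -/
theorem norm_mean_mul_sub_one_pow_le (n k : ℕ) :
    ‖((p : ℂ_[p]) ^ n)⁻¹ * ∑ ζ ∈ Polynomial.nthRootsFinset (p ^ n) (1 : ℂ_[p]),
      ζ * (ζ - 1) ^ k‖ ≤ 1 := by
  have e : ∀ ζ : ℂ_[p], ζ * (ζ - 1) ^ k =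
      ∑ i ∈ Finset.range (k + 1), ((-1) ^ (k - i) * (k.choose i : ℂ_[p])) * ζ ^ (i + 1) := by
    intro ζ
    rw [sub_eq_add_neg, add_pow, Finset.mul_sum]
    exact Finset.sum_congr rfl fun i _ => by ring
  simp only [e]
  rw [Finset.sum_comm, Finset.mul_sum]
  refine IsUltrametricDist.norm_sum_le_of_forall_le_of_nonneg zero_le_one fun i _ => ?_
  rw [← Finset.mul_sum, sum_nthRoots_pow (pow_p_pos n), mul_left_comm, norm_mul]
  refine mul_le_one₀ ?_ (norm_nonneg _) ?_
  · rw [norm_mul, norm_pow, norm_neg, norm_one, one_pow, one_mul]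
    exact norm_natCast_le_one _
  · split_ifs
    · rw [Nat.cast_pow, inv_mul_cancel₀ (pow_p_ne_zero n), norm_one]
    · simp

/-- The means of a function with a bounded power series are bounded by its supremum on the arc,
uniformly in `n`. -/
theorem HasBddSeries.norm_arcMean_le {c : ℕ → ℂ_[p]} {a b : ℂ_[p]} (hab : a ≠ b)
    {g : ℂ_[p] → ℂ_[p]} (h : HasBddSeries c b ‖b - a‖ g) {ε : ℝ} (hε : 0 < ε)
    (hg : ∀ z ∈ arc a b, ‖g z‖ ≤ ε) (n : ℕ) : ‖arcMean a b g n‖ ≤ ‖b - a‖ * ε := by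
  have hd : b - a ≠ 0 := sub_ne_zero.2 hab.symm
  have hc := h.norm_coeff_le hd hε fun T hT => hg _ (by
    rwa [arc, Metric.mem_ball, dist_eq_norm, add_sub_cancel_left])
  have hs : HasSum (fun k => (b - a) * (c k * (b - a) ^ k) * (((p : ℂ_[p]) ^ n)⁻¹ *
      ∑ ζ ∈ Polynomial.nthRootsFinset (p ^ n) (1 : ℂ_[p]), ζ * (ζ - 1) ^ k))
      (arcMean a b g n) := by
    have h1 : ∀ ζ ∈ Polynomial.nthRootsFinset (p ^ n) (1 : ℂ_[p]),
        HasSum (fun k => (b - a) * ζ * (c k * ((b - a) * (ζ - 1)) ^ k))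
          ((a + (b - a) * ζ - a) * g (a + (b - a) * ζ)) := by
      intro ζ hζ
      have hζ1 := norm_sub_one_lt_one_of_pow_eq_one
        ((Polynomial.mem_nthRootsFinset (pow_p_pos n) 1).1 hζ)
      have hlt : ‖(b - a) * (ζ - 1)‖ < ‖b - a‖ := by
        rw [norm_mul]
        exact mul_lt_of_lt_one_right (norm_pos_iff.2 hd) hζ1
      have := (h.hasSum _ hlt).mul_left ((b - a) * ζ)
      rw [show b + (b - a) * (ζ - 1) = a + (b - a) * ζ by ring] at this
      rwa [add_sub_cancel_left]
    have h2 := (hasSum_sum h1).mul_left ((p : ℂ_[p]) ^ n)⁻¹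
    rw [arcMean]
    refine h2.congr_fun ?_
    intro k
    rw [Finset.mul_sum, Finset.mul_sum, Finset.mul_sum]
    exact Finset.sum_congr rfl fun ζ _ => by rw [mul_pow]; ring
  rw [← hs.tsum_eq]
  refine IsUltrametricDist.norm_tsum_le_of_forall_le_of_nonneg (by positivity) fun k => ?_
  rw [norm_mul, norm_mul]
  exact mul_le_of_le_one_right (by positivity) (norm_mean_mul_sub_one_pow_le n k) |>.trans
    (mul_le_mul_of_nonneg_left (hc k) (norm_nonneg _))

/-! ### Approximation by rational functions with simple poles -/

/-- The span of the powers of `z` and of the simple fractions `(z - c)⁻¹` with `c` outside `D`. -/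
def simpleFractions (D : Set ℂ_[p]) : Submodule ℂ_[p] (ℂ_[p] → ℂ_[p]) :=
  Submodule.span ℂ_[p]
    ({g | ∃ k : ℕ, g = fun z => z ^ k} ∪ {g | ∃ c, c ∉ D ∧ g = fun z => (z - c)⁻¹})

theorem pow_mem_simpleFractions (D : Set ℂ_[p]) (k : ℕ) :
    (fun z : ℂ_[p] => z ^ k) ∈ simpleFractions D :=
  Submodule.subset_span (Or.inl ⟨k, rfl⟩)

theorem inv_sub_mem_simpleFractions {D : Set ℂ_[p]} {c : ℂ_[p]} (hc : c ∉ D) :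
    (fun z : ℂ_[p] => (z - c)⁻¹) ∈ simpleFractions D :=
  Submodule.subset_span (Or.inr ⟨c, hc, rfl⟩)

/-- `g` is, on `D`, a uniform limit of functions in `simpleFractions D`. -/
def Approximable (D : Set ℂ_[p]) (g : ℂ_[p] → ℂ_[p]) : Prop :=
  ∀ ε : ℝ, 0 < ε → ∃ s ∈ simpleFractions D, ∀ z ∈ D, ‖g z - s z‖ ≤ ε

namespace Approximable

variable {D : Set ℂ_[p]} {g h : ℂ_[p] → ℂ_[p]}

theorem of_mem (hg : g ∈ simpleFractions D) : Approximable D g :=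
  fun ε hε => ⟨g, hg, fun z _ => by simpa using hε.le⟩

theorem of_forall (H : ∀ ε : ℝ, 0 < ε → ∃ s, Approximable D s ∧ ∀ z ∈ D, ‖g z - s z‖ ≤ ε) :
    Approximable D g := by
  intro ε hε
  obtain ⟨s, hs, h1⟩ := H ε hε
  obtain ⟨t, ht, h2⟩ := hs ε hε
  refine ⟨t, ht, fun z hz => ?_⟩
  rw [← sub_add_sub_cancel (g z) (s z)]
  exact (IsUltrametricDist.norm_add_le_max _ _).trans (max_le (h1 z hz) (h2 z hz))

theorem congr (hg : Approximable D g) (e : ∀ z ∈ D, h z = g z) : Approximable D h :=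
  of_forall fun ε hε => ⟨g, hg, fun z hz => by simpa [e z hz] using hε.le⟩

theorem add (hg : Approximable D g) (hh : Approximable D h) : Approximable D (g + h) := by
  intro ε hε
  obtain ⟨s, hs, h1⟩ := hg ε hε
  obtain ⟨t, ht, h2⟩ := hh ε hε
  refine ⟨s + t, add_mem hs ht, fun z hz => ?_⟩
  rw [Pi.add_apply, Pi.add_apply, add_sub_add_comm]
  exact (IsUltrametricDist.norm_add_le_max _ _).trans (max_le (h1 z hz) (h2 z hz))

theorem smul (a : ℂ_[p]) (hg : Approximable D g) : Approximable D (a • g) := by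
  intro ε hε
  obtain ⟨s, hs, h1⟩ := hg (ε / (‖a‖ + 1)) (by positivity)
  refine ⟨a • s, Submodule.smul_mem _ a hs, fun z hz => ?_⟩
  rw [Pi.smul_apply, Pi.smul_apply, ← smul_sub, norm_smul]
  calc ‖a‖ * ‖g z - s z‖ ≤ (‖a‖ + 1) * (ε / (‖a‖ + 1)) :=
        mul_le_mul (by linarith) (h1 z hz) (norm_nonneg _) (by positivity)
    _ = ε := mul_div_cancel₀ _ (by positivity)

theorem sub (hg : Approximable D g) (hh : Approximable D h) : Approximable D (g - h) := by
  rw [sub_eq_add_neg, ← neg_one_smul ℂ_[p] h]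
  exact hg.add (hh.smul _)

end Approximable

theorem exists_pos_le_norm_sub {D : Set ℂ_[p]} (hD : IsClosed D) {c : ℂ_[p]} (hc : c ∉ D) :
    ∃ δ : ℝ, 0 < δ ∧ ∀ z ∈ D, δ ≤ ‖z - c‖ := by
  obtain ⟨δ, hδ, h⟩ := Metric.isOpen_iff.1 hD.isOpen_compl c hc
  refine ⟨δ, hδ, fun z hz => ?_⟩
  by_contra! hlt
  exact h (by rwa [Metric.mem_ball, dist_eq_norm]) hz

theorem sub_ne_zero_of_mem_of_notMem {D : Set ℂ_[p]} {z c : ℂ_[p]} (hz : z ∈ D) (hc : c ∉ D) :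
    z - c ≠ 0 :=
  sub_ne_zero.2 fun h => hc (h ▸ hz)

theorem approximable_inv_sub_mul_inv_sub {D : Set ℂ_[p]} {c c' : ℂ_[p]} (hc : c ∉ D)
    (hc' : c' ∉ D) (hne : c' ≠ c) : Approximable D (fun z => (z - c')⁻¹ * (z - c)⁻¹) := by
  have : Approximable D
      ((c' - c)⁻¹ • ((fun z : ℂ_[p] => (z - c')⁻¹) - (fun z : ℂ_[p] => (z - c)⁻¹))) :=
    .of_mem (Submodule.smul_mem _ _ (sub_mem (inv_sub_mem_simpleFractions hc')
      (inv_sub_mem_simpleFractions hc)))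
  refine this.congr fun z hz => ?_
  have h1 := sub_ne_zero_of_mem_of_notMem hz hc
  have h2 := sub_ne_zero_of_mem_of_notMem hz hc'
  have h3 := sub_ne_zero.2 hne
  simp only [Pi.smul_apply, Pi.sub_apply, smul_eq_mul]
  field_simp
  ring

/-- A double pole is a limit of pairs of simple poles. -/
theorem approximable_inv_sub_sq {D : Set ℂ_[p]} (hD : IsClosed D) {c : ℂ_[p]} (hc : c ∉ D) :
    Approximable D (fun z => (z - c)⁻¹ * (z - c)⁻¹) := by
  obtain ⟨δ, hδ, hδD⟩ := exists_pos_le_norm_sub hD hc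
  refine .of_forall fun ε hε => ?_
  obtain ⟨t, ht0, ht⟩ := NormedField.exists_norm_lt ℂ_[p] (lt_min hδ (mul_pos hε (pow_pos hδ 3)))
  have ht1 : ‖t‖ < δ := ht.trans_le (min_le_left _ _)
  have hnorm : ∀ z ∈ D, ‖z - (c + t)‖ = ‖z - c‖ := by
    intro z hz
    refine norm_eq_of_norm_sub_lt ?_
    rw [show z - (c + t) - (z - c) = -t by ring, norm_neg]
    exact ht1.trans_le (hδD z hz)
  have hc' : c + t ∉ D := by
    intro h
    have := hδD _ h
    rw [add_sub_cancel_left] at this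
    exact this.not_gt ht1
  refine ⟨_, approximable_inv_sub_mul_inv_sub hc hc' (by simpa using norm_pos_iff.1 ht0),
    fun z hz => ?_⟩
  have h1 := sub_ne_zero_of_mem_of_notMem hz hc
  have h2 := sub_ne_zero_of_mem_of_notMem hz hc'
  have e : (z - c)⁻¹ * (z - c)⁻¹ - (z - (c + t))⁻¹ * (z - c)⁻¹ =
      -t / ((z - (c + t)) * (z - c) * (z - c)) := by
    field_simp
    ring
  rw [e, norm_div, norm_neg, norm_mul, norm_mul, hnorm z hz,
    div_le_iff₀ (by have := norm_pos_iff.2 h1; positivity)]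
  refine (ht.trans_le (min_le_right _ _)).le.trans (mul_le_mul_of_nonneg_left ?_ hε.le)
  calc δ ^ 3 ≤ ‖z - c‖ ^ 3 := pow_le_pow_left₀ hδ.le (hδD z hz) 3
    _ = ‖z - c‖ * ‖z - c‖ * ‖z - c‖ := by ring

theorem Approximable.mul_inv_sub {D : Set ℂ_[p]} (hD : IsClosed D) {c : ℂ_[p]} (hc : c ∉ D)
    {g : ℂ_[p] → ℂ_[p]} (hg : Approximable D g) : Approximable D (fun z => g z * (z - c)⁻¹) := by
  obtain ⟨δ, hδ, hδD⟩ := exists_pos_le_norm_sub hD hc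
  have key : ∀ s ∈ simpleFractions D, Approximable D (fun z => s z * (z - c)⁻¹) := by
    intro s hs
    induction hs using Submodule.span_induction with
    | mem s hs =>
      rcases hs with ⟨k, rfl⟩ | ⟨c', hc', rfl⟩
      · induction k with
        | zero =>
          exact (Approximable.of_mem (inv_sub_mem_simpleFractions hc)).congr fun z _ => by simp
        | succ k ih =>
          refine ((Approximable.of_mem (pow_mem_simpleFractions D k)).add (ih.smul c)).congr
            fun z hz => ?_
          have := sub_ne_zero_of_mem_of_notMem hz hc
          simp only [Pi.add_apply, Pi.smul_apply, smul_eq_mul]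
          field_simp
          ring
      · rcases eq_or_ne c' c with rfl | hne
        · exact approximable_inv_sub_sq hD hc
        · exact approximable_inv_sub_mul_inv_sub hc hc' hne
    | zero => exact (Approximable.of_mem (zero_mem _)).congr fun z _ => by simp
    | add s t _ _ hs ht => exact (hs.add ht).congr fun z _ => by simp [add_mul]
    | smul a s _ hs => exact (hs.smul a).congr fun z _ => by simp [mul_assoc]
  refine .of_forall fun ε hε => ?_
  obtain ⟨s, hs, h⟩ := hg (ε * δ) (mul_pos hε hδ)
  refine ⟨_, key s hs, fun z hz => ?_⟩
  rw [← sub_mul, norm_mul, norm_inv, ← div_eq_mul_inv, div_le_iff₀ (hδ.trans_le (hδD z hz))]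
  exact (h z hz).trans (mul_le_mul_of_nonneg_left (hδD z hz) hε.le)

theorem approximable_eval_div_eval {D : Set ℂ_[p]} (hD : IsClosed D) (P Q : Polynomial ℂ_[p])
    (hQ : ∀ z ∈ D, Q.eval z ≠ 0) : Approximable D (fun z => P.eval z / Q.eval z) := by
  have hP : Approximable D (fun z => P.eval z) := by
    have : (∑ i ∈ Finset.range (P.natDegree + 1), P.coeff i • fun z : ℂ_[p] => z ^ i) ∈
        simpleFractions D :=
      sum_mem fun i _ => Submodule.smul_mem _ _ (pow_mem_simpleFractions D i)
    refine (Approximable.of_mem this).congr fun z _ => ?_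
    rw [Polynomial.eval_eq_sum_range, Finset.sum_apply]
    rfl
  have key : ∀ S : Multiset ℂ_[p], (∀ c ∈ S, c ∉ D) →
      Approximable D (fun z => P.eval z * (S.map fun c => (z - c)⁻¹).prod) := by
    intro S
    induction S using Multiset.induction with
    | empty => exact fun _ => hP.congr fun z _ => by simp
    | cons c S ih =>
      intro h
      refine ((ih fun c' hc' => h c' (Multiset.mem_cons_of_mem hc')).mul_inv_sub hD
        (h c (Multiset.mem_cons_self c S))).congr fun z _ => ?_
      rw [Multiset.map_cons, Multiset.prod_cons]
      ring
  rcases eq_or_ne Q 0 with rfl | hQ0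
  · -- then `D` is empty
    exact (Approximable.of_mem (zero_mem _)).congr fun z hz => absurd (by simp) (hQ z hz)
  have hr : ∀ c ∈ Q.roots, c ∉ D := fun c hc hcD =>
    hQ c hcD ((Polynomial.mem_roots hQ0).1 hc)
  refine ((key Q.roots hr).smul Q.leadingCoeff⁻¹).congr fun z _ => ?_
  have e := congrArg (Polynomial.eval z) (IsAlgClosed.splits Q).eq_prod_roots
  rw [Polynomial.eval_mul, Polynomial.eval_C, Polynomial.eval_multiset_prod, Multiset.map_map] at e
  rw [e, Pi.smul_apply, smul_eq_mul, Multiset.prod_map_inv, div_eq_mul_inv, mul_inv]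
  simp only [Function.comp, Polynomial.eval_sub, Polynomial.eval_X, Polynomial.eval_C]
  ring

theorem KrasnerAnalyticOn.approximable {D : Set ℂ_[p]} (hD : IsClosed D) {f : ℂ_[p] → ℂ_[p]}
    (hf : KrasnerAnalyticOn f D) : Approximable D f := by
  obtain ⟨P, Q, hQ, hl⟩ := hf
  refine .of_forall fun ε hε => ?_
  obtain ⟨n, hn⟩ := (Metric.tendstoUniformlyOn_iff.1 hl ε hε).exists
  refine ⟨_, approximable_eval_div_eval hD (P n) (Q n) (hQ n), fun z hz => ?_⟩
  rw [← dist_eq_norm]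
  exact (hn z hz).le

/-! ### Integrals of Krasner analytic functions -/

theorem mem_arc_of_pow_eq_one {a b ζ : ℂ_[p]} (hab : a ≠ b) {n : ℕ} (h : ζ ^ p ^ n = 1) :
    a + (b - a) * ζ ∈ arc a b := by
  rw [arc, Metric.mem_ball, dist_eq_norm, show a + (b - a) * ζ - b = (b - a) * (ζ - 1) by ring,
    norm_mul]
  exact mul_lt_of_lt_one_right (norm_pos_iff.2 (sub_ne_zero.2 hab.symm))
    (norm_sub_one_lt_one_of_pow_eq_one h)

theorem exists_hasBddSeries {D : Set ℂ_[p]} {a b : ℂ_[p]} (hab : a ≠ b) (harc : arc a b ⊆ D)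
    {s : ℂ_[p] → ℂ_[p]} (hs : s ∈ simpleFractions D) : ∃ c, HasBddSeries c b ‖b - a‖ s := by
  have h0 : 0 < ‖b - a‖ := norm_pos_iff.2 (sub_ne_zero.2 hab.symm)
  induction hs using Submodule.span_induction with
  | mem s hs =>
    rcases hs with ⟨k, rfl⟩ | ⟨c, hc, rfl⟩
    · exact ⟨_, .pow b h0.le k⟩
    · refine ⟨_, .inv_sub h0 ?_⟩
      by_contra! h
      exact hc (harc (by rwa [arc, Metric.mem_ball, dist_eq_norm]))
  | zero => exact ⟨_, .zero b _⟩
  | add s t _ _ hs ht =>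
    obtain ⟨c, hc⟩ := hs
    obtain ⟨c', hc'⟩ := ht
    exact ⟨_, hc.add h0.le hc'⟩
  | smul k s _ hs =>
    obtain ⟨c, hc⟩ := hs
    exact ⟨_, hc.smul k⟩

/-- The means on an arc inside `D` are bounded, uniformly in `n`, by the supremum on `D`. This makes
them compatible with uniform limits, although the individual mean has the denominator `p ^ n`. -/
theorem Approximable.norm_arcMean_le {D : Set ℂ_[p]} {a b : ℂ_[p]} (hab : a ≠ b)
    (harc : arc a b ⊆ D) {g : ℂ_[p] → ℂ_[p]} (hg : Approximable D g) {ε : ℝ} (hε : 0 < ε)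
    (h : ∀ z ∈ D, ‖g z‖ ≤ ε) (n : ℕ) : ‖arcMean a b g n‖ ≤ ‖b - a‖ * ε := by
  -- `g` is replaced by a simple fraction so close to it that the denominator `p ^ n` is harmless
  have hp0 : 0 < ‖(p : ℂ_[p]) ^ n‖ := norm_pos_iff.2 (pow_p_ne_zero n)
  have hp1 : ‖(p : ℂ_[p]) ^ n‖ ≤ 1 := by
    rw [norm_pow]
    exact pow_le_one₀ (norm_nonneg _) norm_p_lt_one.le
  obtain ⟨s, hs, hgs⟩ := hg (‖(p : ℂ_[p]) ^ n‖ * ε) (mul_pos hp0 hε)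
  obtain ⟨c, hc⟩ := exists_hasBddSeries hab harc hs
  have h1 : ‖arcMean a b s n‖ ≤ ‖b - a‖ * ε := by
    refine hc.norm_arcMean_le hab hε (fun z hz => ?_) n
    rw [← sub_sub_cancel (g z) (s z)]
    exact (norm_sub_le_max _ _).trans (max_le (h z (harc hz))
      ((hgs z (harc hz)).trans (mul_le_of_le_one_left hε.le hp1)))
  have h2 : ‖arcMean a b (g - s) n‖ ≤ ‖b - a‖ * ε := by
    rw [arcMean, norm_mul, norm_inv, inv_mul_le_iff₀ hp0, mul_left_comm]
    refine IsUltrametricDist.norm_sum_le_of_forall_le_of_nonneg (by positivity) fun ζ hζ => ?_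
    rw [Polynomial.mem_nthRootsFinset (pow_p_pos n)] at hζ
    have hζ1 : ‖ζ‖ = 1 := by
      refine norm_eq_of_norm_sub_lt' (norm_sub_one_lt_one_of_pow_eq_one hζ) norm_one
    rw [norm_mul, add_sub_cancel_left, norm_mul, hζ1, mul_one]
    exact mul_le_mul_of_nonneg_left (hgs _ (harc (mem_arc_of_pow_eq_one hab hζ))) (norm_nonneg _)
  rw [← sub_add_cancel g s, arcMean_add]
  exact (IsUltrametricDist.norm_add_le_max _ _).trans (max_le h2 h1)

theorem exists_tendsto_arcMean_of_mem {D : Set ℂ_[p]} {a b : ℂ_[p]} (hab : a ≠ b)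
    (harc : arc a b ⊆ D) (α : ℕ) {s : ℂ_[p] → ℂ_[p]} (hs : s ∈ simpleFractions D) :
    ∃ L, Tendsto (arcMean a b s) (linFilter α) (𝓝 L) := by
  induction hs using Submodule.span_induction with
  | mem s hs =>
    rcases hs with ⟨k, rfl⟩ | ⟨c, hc, rfl⟩
    · exact ⟨0, (tendsto_arcMean_pow a b k).mono_left (linFilter_le_atTop α)⟩
    · have hc' : c ∉ arc a b := fun h => hc (harc h)
      obtain ⟨w, hw⟩ := exists_tendsto_weight α (one_le_norm_pole hab hc')
      exact ⟨w, hw.congr fun n => (arcMean_inv_sub hab hc' n).symm⟩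
  | zero => exact ⟨0, tendsto_const_nhds.congr fun n => (arcMean_zero a b n).symm⟩
  | add s t _ _ hs ht =>
    obtain ⟨L, hL⟩ := hs
    obtain ⟨L', hL'⟩ := ht
    exact ⟨L + L', (hL.add hL').congr fun n => (arcMean_add a b s t n).symm⟩
  | smul k s _ hs =>
    obtain ⟨L, hL⟩ := hs
    exact ⟨k * L, (hL.const_mul k).congr fun n => (arcMean_smul a b k s n).symm⟩

theorem Approximable.exists_tendsto_arcMean {D : Set ℂ_[p]} {a b : ℂ_[p]} (hab : a ≠ b)
    (harc : arc a b ⊆ D) (α : ℕ) {f : ℂ_[p] → ℂ_[p]} (hf : Approximable D f) :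
    ∃ L, Tendsto (arcMean a b f) (linFilter α) (𝓝 L) := by
  have h0 : 0 < ‖b - a‖ := norm_pos_iff.2 (sub_ne_zero.2 hab.symm)
  suffices h : Cauchy (map (arcMean a b f) (linFilter α)) from
    CompleteSpace.complete h
  refine Metric.cauchy_iff.2 ⟨inferInstance, fun ε hε => ?_⟩
  obtain ⟨s, hs, hfs⟩ := hf (ε / 4 / ‖b - a‖) (by positivity)
  obtain ⟨L, hL⟩ := exists_tendsto_arcMean_of_mem hab harc α hs
  have hb := fun n => (hf.sub (.of_mem hs)).norm_arcMean_le hab harc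
    (show 0 < ε / 4 / ‖b - a‖ by positivity) hfs n
  rw [mul_div_cancel₀ _ h0.ne'] at hb
  refine ⟨Metric.ball L (ε / 2), ?_, fun x hx y hy => ?_⟩
  · refine mem_map.2 ?_
    filter_upwards [Metric.tendsto_nhds.1 hL (ε / 4) (by positivity)] with n hn
    have h1 := hb n
    rw [arcMean_sub, ← dist_eq_norm] at h1
    have := dist_triangle (arcMean a b f n) (arcMean a b s n) L
    rw [Set.mem_preimage, Metric.mem_ball]
    linarith
  · have := dist_triangle_right x y L
    rw [Metric.mem_ball] at hx hy
    linarith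

/-- A linear relation between arc integrals holds for all approximable functions as soon as it holds
for simple poles. -/
theorem Approximable.tendsto_sum_arcMean {ι : Type*} [Fintype ι] {D : Set ℂ_[p]}
    {A B κ : ι → ℂ_[p]} (hab : ∀ i, A i ≠ B i) (harc : ∀ i, arc (A i) (B i) ⊆ D) (α : ℕ)
    (H : ∀ c ∉ D, Tendsto (fun n => ∑ i, κ i * (1 - ((c - A i) / (B i - A i)) ^ p ^ n)⁻¹)
      (linFilter α) (𝓝 0))
    {f : ℂ_[p] → ℂ_[p]} (hf : Approximable D f) :
    Tendsto (fun n => ∑ i, κ i * arcMean (A i) (B i) f n) (linFilter α) (𝓝 0) := by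
  have key : ∀ s ∈ simpleFractions D,
      Tendsto (fun n => ∑ i, κ i * arcMean (A i) (B i) s n) (linFilter α) (𝓝 0) := by
    intro s hs
    induction hs using Submodule.span_induction with
    | mem s hs =>
      rcases hs with ⟨k, rfl⟩ | ⟨c, hc, rfl⟩
      · simpa using tendsto_finsetSum Finset.univ fun i _ =>
          ((tendsto_arcMean_pow (A i) (B i) k).mono_left (linFilter_le_atTop α)).const_mul (κ i)
      · refine (H c hc).congr fun n => Finset.sum_congr rfl fun i _ => ?_
        rw [arcMean_inv_sub (hab i) fun h => hc (harc i h)]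
    | zero => simp [arcMean_zero]
    | add s t _ _ hs ht =>
      simpa [arcMean_add, mul_add, Finset.sum_add_distrib] using hs.add ht
    | smul k s _ hs =>
      simpa [arcMean_smul, Finset.mul_sum, mul_left_comm] using hs.const_mul k
  refine Metric.tendsto_nhds.2 fun ε hε => ?_
  set C : ℝ := ∑ i, ‖κ i‖ * ‖B i - A i‖ with hC
  have hC0 : 0 ≤ C := Finset.sum_nonneg fun i _ => by positivity
  obtain ⟨s, hs, hfs⟩ := hf (ε / 2 / (C + 1)) (by positivity)
  filter_upwards [Metric.tendsto_nhds.1 (key s hs) (ε / 2) (by positivity)] with n hn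
  rw [dist_zero_right] at hn ⊢
  have e : ∑ i, κ i * arcMean (A i) (B i) f n =
      ∑ i, κ i * arcMean (A i) (B i) (f - s) n + ∑ i, κ i * arcMean (A i) (B i) s n := by
    rw [← Finset.sum_add_distrib]
    refine Finset.sum_congr rfl fun i _ => ?_
    rw [arcMean_sub]
    ring
  have h1 : ‖∑ i, κ i * arcMean (A i) (B i) (f - s) n‖ ≤ C * (ε / 2 / (C + 1)) := by
    rw [hC, Finset.sum_mul]
    refine (norm_sum_le _ _).trans (Finset.sum_le_sum fun i _ => ?_)
    rw [norm_mul, mul_assoc]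
    exact mul_le_mul_of_nonneg_left ((hf.sub (.of_mem hs)).norm_arcMean_le (hab i) (harc i)
      (by positivity) hfs n) (norm_nonneg _)
  have h2 : C * (ε / 2 / (C + 1)) ≤ ε / 2 := by
    calc C * (ε / 2 / (C + 1)) ≤ (C + 1) * (ε / 2 / (C + 1)) :=
          mul_le_mul_of_nonneg_right (by linarith) (by positivity)
      _ = ε / 2 := mul_div_cancel₀ _ (by positivity)
  rw [e]
  have := norm_add_le (∑ i, κ i * arcMean (A i) (B i) (f - s) n)
    (∑ i, κ i * arcMean (A i) (B i) s n)
  linarith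

/-! ### Cauchy matrices -/

/-- A Cauchy matrix is nonsingular: a relation between its columns is a polynomial of degree less
than `T.card` that vanishes at all `v i`. -/
theorem eq_zero_of_cauchy_sum_eq_zero {k ι : Type*} [Field k] {T : Finset ι} {v y c : ι → k}
    (hv : Set.InjOn v T) (hy : Set.InjOn y T) (hvy : ∀ i ∈ T, ∀ j ∈ T, v i ≠ y j)
    (h : ∀ i ∈ T, ∑ j ∈ T, c j / (v i - y j) = 0) : ∀ j ∈ T, c j = 0 := by
  classical
  set P : Polynomial k := ∑ j ∈ T, Polynomial.C (c j) *
    ∏ l ∈ T.erase j, (Polynomial.X - Polynomial.C (y l)) with hP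
  have hdeg : P.degree < T.card := by
    rw [← Polynomial.mem_degreeLT]
    refine sum_mem fun j hj => ?_
    rw [Polynomial.mem_degreeLT]
    have hpos : 0 < T.card := Finset.card_pos.2 ⟨j, hj⟩
    refine Polynomial.degree_le_natDegree.trans_lt (Nat.cast_lt.2
      ((Polynomial.natDegree_C_mul_le _ _).trans_lt ?_))
    rw [Polynomial.natDegree_finsetProd_X_sub_C_eq_card, Finset.card_erase_of_mem hj]
    exact Nat.sub_lt hpos one_pos
  have hev : ∀ x, P.eval x = ∑ j ∈ T, c j * ∏ l ∈ T.erase j, (x - y l) := fun x => by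
    simp [hP, Polynomial.eval_finsetSum, Polynomial.eval_prod]
  have hP0 : P = 0 := by
    refine Polynomial.eq_zero_of_degree_lt_of_eval_index_eq_zero (v := v) T hv hdeg fun i hi => ?_
    have hne : ∀ j ∈ T, v i - y j ≠ 0 := fun j hj => sub_ne_zero.2 (hvy i hi j hj)
    rw [hev, ← mul_zero (∏ l ∈ T, (v i - y l)), ← h i hi, Finset.mul_sum]
    refine Finset.sum_congr rfl fun j hj => ?_
    rw [← Finset.mul_prod_erase T _ hj]
    have := hne j hj
    field_simp
  intro j hj
  have h1 := hev (y j)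
  rw [hP0, Polynomial.eval_zero, Finset.sum_eq_single_of_mem j hj] at h1
  · refine (mul_eq_zero.1 h1.symm).resolve_right (Finset.prod_ne_zero_iff.2 fun l hl => ?_)
    have hl' := Finset.mem_erase.1 hl
    exact sub_ne_zero.2 fun e => hl'.1 (hy hl'.2 hj e.symm)
  · intro l _ hlj
    exact mul_eq_zero_of_right _
      (Finset.prod_eq_zero (Finset.mem_erase.2 ⟨hlj.symm, hj⟩) (sub_self _))

/-! ### Discs with holes -/

theorem isClosed_holedDisc {M : ℕ} (a : ℂ_[p]) (R : ℝ) (x : Fin M → ℂ_[p]) (ρ : Fin M → ℝ) :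
    IsClosed (holedDisc a R x ρ) := by
  rw [holedDisc, Set.sdiff_eq]
  exact Metric.isClosed_closedBall.inter (isOpen_iUnion fun i => Metric.isOpen_ball).isClosed_compl

theorem mem_holedDisc {M : ℕ} {a z : ℂ_[p]} {R : ℝ} {x : Fin M → ℂ_[p]} {ρ : Fin M → ℝ} :
    z ∈ holedDisc a R x ρ ↔ ‖z - a‖ ≤ R ∧ ∀ i, ρ i ≤ ‖z - x i‖ := by
  simp [holedDisc, dist_eq_norm]

/-- A disc with holes, together with arcs of its boundary circle and of circles around the holes, in
the position required by the Cauchy-Goursat theorem. -/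
structure IsConfig {M : ℕ} (m : ℕ) (a b : ℂ_[p]) (R : ℝ) (x b' : Fin M → ℂ_[p])
    (ρ r : Fin M → ℝ) : Prop where
  R_pos : 0 < R
  rho_pos : ∀ i, 0 < ρ i
  rho_eq : ∀ i : Fin M, (i : ℕ) < m → ρ i = R
  rho_lt : ∀ i : Fin M, m ≤ (i : ℕ) → ρ i < R
  disjoint : ∀ i j, i ≠ j → Disjoint (Metric.ball (x i) (ρ i)) (Metric.ball (x j) (ρ j))
  b_mem : b ∈ Metric.sphere a R
  norm_b_sub : ∀ i, ‖b - x i‖ = R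
  r_bounds : ∀ i, ρ i ≤ r i ∧ r i ≤ R
  disjoint_closed : ∀ i j : Fin M, m ≤ (i : ℕ) → m ≤ (j : ℕ) → i ≠ j →
    Disjoint (Metric.closedBall (x i) (r i)) (Metric.closedBall (x j) (r j))
  arc_mem_sphere : ∀ i, b' i ∈ Metric.sphere (x i) (r i)
  arc_mem : ∀ i, b' i ∈ holedDisc a R x ρ
  norm_arc_sub : ∀ i : Fin M, (i : ℕ) < m → ∀ j, ‖b' i - x j‖ = R
  norm_arc_sub_arc : ∀ i : Fin M, (i : ℕ) < m → ∀ j, i ≠ j → ‖b' i - b' j‖ = R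

namespace IsConfig

variable {M m : ℕ} {a b : ℂ_[p]} {R : ℝ} {x b' : Fin M → ℂ_[p]} {ρ r : Fin M → ℝ}

theorem norm_b_sub_a (h : IsConfig m a b R x b' ρ r) : ‖b - a‖ = R := by
  simpa [dist_eq_norm] using h.b_mem

theorem ne (h : IsConfig m a b R x b' ρ r) : a ≠ b := by
  rintro rfl
  have := h.norm_b_sub_a
  rw [sub_self, norm_zero] at this
  exact h.R_pos.ne this

theorem norm_arc_sub_center (h : IsConfig m a b R x b' ρ r) (i : Fin M) : ‖b' i - x i‖ = r i := by
  simpa [dist_eq_norm] using h.arc_mem_sphere i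

theorem r_pos (h : IsConfig m a b R x b' ρ r) (i : Fin M) : 0 < r i :=
  (h.rho_pos i).trans_le (h.r_bounds i).1

theorem r_eq (h : IsConfig m a b R x b' ρ r) {i : Fin M} (hi : (i : ℕ) < m) : r i = R :=
  le_antisymm (h.r_bounds i).2 ((h.rho_eq i hi).symm.le.trans (h.r_bounds i).1)

theorem rho_le (h : IsConfig m a b R x b' ρ r) (i : Fin M) : ρ i ≤ R :=
  (h.r_bounds i).1.trans (h.r_bounds i).2

theorem center_ne (h : IsConfig m a b R x b' ρ r) (i : Fin M) : x i ≠ b' i := by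
  intro e
  have := h.norm_arc_sub_center i
  rw [e, sub_self, norm_zero] at this
  exact (h.r_pos i).ne this

theorem norm_center_sub_le (h : IsConfig m a b R x b' ρ r) (i : Fin M) : ‖x i - a‖ ≤ R := by
  rw [← sub_sub_sub_cancel_left _ _ b]
  exact (norm_sub_le_max _ _).trans (max_le h.norm_b_sub_a.le (h.norm_b_sub i).le)

theorem norm_center_sub_center_le (h : IsConfig m a b R x b' ρ r) (i j : Fin M) :
    ‖x i - x j‖ ≤ R := by
  rw [← sub_sub_sub_cancel_right _ _ a]
  exact (norm_sub_le_max _ _).trans (max_le (h.norm_center_sub_le i) (h.norm_center_sub_le j))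

theorem rho_le_norm_center_sub (h : IsConfig m a b R x b' ρ r) {i j : Fin M} (hij : i ≠ j) :
    ρ j ≤ ‖x i - x j‖ := by
  by_contra! hlt
  exact Set.disjoint_left.1 (h.disjoint i j hij) (Metric.mem_ball_self (h.rho_pos i))
    (by rwa [Metric.mem_ball, dist_eq_norm])

theorem norm_center_sub_eq (h : IsConfig m a b R x b' ρ r) {i j : Fin M} (hi : (i : ℕ) < m)
    (hij : i ≠ j) : ‖x i - x j‖ = R := by
  refine le_antisymm (h.norm_center_sub_center_le i j) ?_
  rw [norm_sub_rev, ← h.rho_eq i hi]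
  exact h.rho_le_norm_center_sub hij.symm

theorem r_lt_norm_center_sub (h : IsConfig m a b R x b' ρ r) {i j : Fin M} (hi : m ≤ (i : ℕ))
    (hj : m ≤ (j : ℕ)) (hij : i ≠ j) : r i < ‖x i - x j‖ := by
  by_contra! hle
  exact Set.disjoint_left.1 (h.disjoint_closed i j hi hj hij)
    (by rwa [Metric.mem_closedBall, dist_eq_norm, norm_sub_rev])
    (Metric.mem_closedBall_self (h.r_pos j).le)

theorem arc_subset (h : IsConfig m a b R x b' ρ r) : arc a b ⊆ holedDisc a R x ρ := by
  intro z hz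
  rw [arc, Metric.mem_ball, dist_eq_norm, h.norm_b_sub_a] at hz
  refine mem_holedDisc.2 ⟨?_, fun i => ?_⟩
  · rw [← sub_add_sub_cancel z b a]
    exact (IsUltrametricDist.norm_add_le_max _ _).trans (max_le hz.le h.norm_b_sub_a.le)
  · rw [norm_eq_of_norm_sub_lt' (y := b - x i) (by rwa [sub_sub_sub_cancel_right]) (h.norm_b_sub i)]
    exact h.rho_le i

theorem arc_subset' (h : IsConfig m a b R x b' ρ r) (i : Fin M) :
    arc (x i) (b' i) ⊆ holedDisc a R x ρ := by
  intro z hz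
  rw [arc, Metric.mem_ball, dist_eq_norm, h.norm_arc_sub_center] at hz
  have hb := mem_holedDisc.1 (h.arc_mem i)
  refine mem_holedDisc.2 ⟨?_, fun j => ?_⟩
  · rw [← sub_add_sub_cancel z (b' i) a]
    exact (IsUltrametricDist.norm_add_le_max _ _).trans
      (max_le (hz.le.trans (h.r_bounds i).2) hb.1)
  · by_contra! hlt
    -- otherwise `x j` lies on the arc, which the position of the holes excludes
    have hle : ‖b' i - x j‖ ≤ max ‖z - b' i‖ ‖z - x j‖ := by
      rw [max_comm, ← sub_sub_sub_cancel_left _ _ z]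
      exact norm_sub_le_max _ _
    have hr : ‖b' i - x j‖ < r i := by
      rcases le_max_iff.1 hle with h1 | h1
      · exact h1.trans_lt hz
      · exact absurd (hb.2 j) (h1.trans_lt hlt).not_ge
    have hji : j ≠ i := by
      rintro rfl
      exact hr.ne (h.norm_arc_sub_center _)
    have hx : ‖x i - x j‖ = r i := by
      rw [norm_sub_rev]
      refine norm_eq_of_norm_sub_lt' (y := b' i - x i) ?_ (h.norm_arc_sub_center i)
      rwa [sub_sub_sub_cancel_right, norm_sub_rev]
    rcases lt_or_ge (i : ℕ) m with hi | hi
    · rw [h.norm_arc_sub i hi j] at hr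
      exact hr.not_ge (h.r_bounds i).2
    · rcases lt_or_ge (j : ℕ) m with hj | hj
      · have := hb.2 j
        rw [h.rho_eq j hj] at this
        exact hr.not_ge ((h.r_bounds i).2.trans this)
      · exact (h.r_lt_norm_center_sub hi hj hji.symm).ne' hx

theorem center_notMem (h : IsConfig m a b R x b' ρ r) (j : Fin M) : x j ∉ holedDisc a R x ρ := by
  intro hx
  have := (mem_holedDisc.1 hx).2 j
  rw [sub_self, norm_zero] at this
  exact this.not_gt (h.rho_pos j)

theorem one_le_norm_pole (h : IsConfig m a b R x b' ρ r) {c : ℂ_[p]} (hc : c ∉ holedDisc a R x ρ) :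
    1 ≤ ‖(c - a) / (b - a) - 1‖ :=
  PadicArc.one_le_norm_pole h.ne fun hm => hc (h.arc_subset hm)

theorem one_le_norm_pole' (h : IsConfig m a b R x b' ρ r) (i : Fin M) {c : ℂ_[p]}
    (hc : c ∉ holedDisc a R x ρ) : 1 ≤ ‖(c - x i) / (b' i - x i) - 1‖ :=
  PadicArc.one_le_norm_pole (h.center_ne i) fun hm => hc (h.arc_subset' i hm)

/-- The weight of a pole `c` on the boundary arc depends only on the hole that contains `c`. -/
theorem tendsto_weight_sub_center (h : IsConfig m a b R x b' ρ r) {c : ℂ_[p]} {j : Fin M}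
    (hc : c ∉ holedDisc a R x ρ) (hcj : ‖c - x j‖ < ρ j) :
    Tendsto (fun n : ℕ => (1 - ((c - a) / (b - a)) ^ p ^ n)⁻¹ -
      (1 - ((x j - a) / (b - a)) ^ p ^ n)⁻¹) atTop (𝓝 0) := by
  refine tendsto_weight_sub (h.one_le_norm_pole hc) (h.one_le_norm_pole (h.center_notMem j))
    (Or.inl ?_)
  rw [← sub_div, sub_sub_sub_cancel_right, norm_div, h.norm_b_sub_a, div_lt_one h.R_pos]
  exact hcj.trans_le (h.rho_le j)

/-- The weight of a pole `c` on the arc around a hole depends only on the hole that contains `c`. -/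
theorem tendsto_weight_sub_center' (h : IsConfig m a b R x b' ρ r) {c : ℂ_[p]} {j : Fin M}
    (hc : c ∉ holedDisc a R x ρ) (hcj : ‖c - x j‖ < ρ j) (i : Fin M) :
    Tendsto (fun n : ℕ => (1 - ((c - x i) / (b' i - x i)) ^ p ^ n)⁻¹ -
      (1 - ((x j - x i) / (b' i - x i)) ^ p ^ n)⁻¹) atTop (𝓝 0) := by
  refine tendsto_weight_sub (h.one_le_norm_pole' i hc) (h.one_le_norm_pole' i (h.center_notMem j))
    ?_
  rcases le_or_gt (ρ j) (r i) with hle | hlt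
  · left
    rw [← sub_div, sub_sub_sub_cancel_right, norm_div, h.norm_arc_sub_center, div_lt_one (h.r_pos i)]
    exact hcj.trans_le hle
  · right
    have hij : i ≠ j := by
      rintro rfl
      exact hlt.not_ge (h.r_bounds _).1
    have h1 : ρ j ≤ ‖x j - x i‖ := by
      rw [norm_sub_rev]
      exact h.rho_le_norm_center_sub hij
    have h2 : ‖c - x i‖ = ‖x j - x i‖ := by
      refine norm_eq_of_norm_sub_lt ?_
      rw [sub_sub_sub_cancel_right]
      exact hcj.trans_le h1
    rw [norm_div, norm_div, h2, h.norm_arc_sub_center, one_lt_div (h.r_pos i)]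
    exact ⟨hlt.trans_le h1, hlt.trans_le h1⟩

variable (p x b') in
/-- The `n`-th weights of the poles `x j` on the arcs around the holes. -/
def weightMatrix (n : ℕ) : Matrix (Fin M) (Fin M) ℂ_[p] :=
  Matrix.of fun i j => (1 - ((x j - x i) / (b' i - x i)) ^ p ^ n)⁻¹

theorem norm_weightMatrix_le (h : IsConfig m a b R x b' ρ r) (n : ℕ) (i j : Fin M) :
    ‖weightMatrix p x b' n i j‖ ≤ 1 := by
  rw [weightMatrix, Matrix.of_apply, norm_inv]
  refine inv_le_one_of_one_le₀ ?_
  rcases le_or_gt ‖(x j - x i) / (b' i - x i)‖ 1 with h1 | h1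
  · exact one_le_norm_one_sub_pow h1 (h.one_le_norm_pole' i (h.center_notMem j)) n
  · rw [norm_one_sub_pow_of_one_lt h1]
    exact one_le_pow₀ h1.le

theorem norm_weightMatrix_lt (h : IsConfig m a b R x b' ρ r) (n : ℕ) {i j : Fin M}
    (hij : r i < ‖x j - x i‖) : ‖weightMatrix p x b' n i j‖ < 1 := by
  have h1 : 1 < ‖(x j - x i) / (b' i - x i)‖ := by
    rwa [norm_div, h.norm_arc_sub_center, one_lt_div (h.r_pos i)]
  rw [weightMatrix, Matrix.of_apply, norm_inv, norm_one_sub_pow_of_one_lt h1]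
  exact inv_lt_one_of_one_lt₀ (one_lt_pow₀ h1 (pow_p_pos n).ne')

theorem weightMatrix_self (n : ℕ) (i : Fin M) : weightMatrix p x b' n i i = 1 := by
  simp [weightMatrix, (Fact.out : p.Prime).ne_zero]

theorem r_lt_norm_center_sub_of_r_lt (h : IsConfig m a b R x b' ρ r) {i j : Fin M} (hi : r i < R)
    (hij : i ≠ j) : r i < ‖x j - x i‖ := by
  have him : m ≤ (i : ℕ) := not_lt.1 fun hm => hi.ne (h.r_eq hm)
  rcases lt_or_ge (j : ℕ) m with hj | hj
  · rwa [h.norm_center_sub_eq hj hij.symm]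
  · rw [norm_sub_rev]
    exact h.r_lt_norm_center_sub him hj hij

/-- Among the circles of radius `R` at most one belongs to a hole of radius less than `R`. -/
theorem lt_or_lt (h : IsConfig m a b R x b' ρ r) {i j : Fin M} (hi : r i = R) (hij : i ≠ j) :
    (i : ℕ) < m ∨ (j : ℕ) < m := by
  by_contra! hn
  have := h.r_lt_norm_center_sub hn.1 hn.2 hij
  exact (hi ▸ this).not_ge (h.norm_center_sub_center_le i j)

theorem norm_arc_sub_center_eq (h : IsConfig m a b R x b' ρ r) {i : Fin M} (hi : r i = R)
    (j : Fin M) : ‖b' i - x j‖ = R := by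
  rcases eq_or_ne i j with rfl | hij
  · rw [h.norm_arc_sub_center, hi]
  · rcases h.lt_or_lt hi hij with h1 | h1
    · exact h.norm_arc_sub i h1 j
    · refine le_antisymm ?_ ?_
      · rw [← sub_sub_sub_cancel_right _ _ a]
        exact (norm_sub_le_max _ _).trans (max_le (mem_holedDisc.1 (h.arc_mem i)).1
          (h.norm_center_sub_le j))
      · rw [← h.rho_eq j h1]
        exact (mem_holedDisc.1 (h.arc_mem i)).2 j

/-- Modulo the maximal ideal, the rows of `weightMatrix n` that belong to circles of radius `R` are,
up to a factor, those of a Cauchy matrix, and the other rows are those of the identity matrix. -/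
theorem norm_det_weightMatrix (h : IsConfig m a b R x b' ρ r) (n : ℕ) :
    1 ≤ ‖(weightMatrix p x b' n).det‖ := by
  classical
  have hba : b - a ≠ 0 := sub_ne_zero.2 h.ne.symm
  let W : Matrix (Fin M) (Fin M) (unitBall p) :=
    Matrix.of fun i j => ⟨weightMatrix p x b' n i j, mem_unitBall.2 (h.norm_weightMatrix_le n i j)⟩
  have hdet : (weightMatrix p x b' n).det = ((W.det : unitBall p) : ℂ_[p]) :=
    (RingHom.map_det (unitBall p).subtype W).symm
  -- the points `x j` and `b' i` in a coordinate in which the disc is the unit disc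
  let X : Fin M → unitBall p := fun j => ⟨(x j - a) / (b - a), mem_unitBall.2 (by
    rw [norm_div, h.norm_b_sub_a]
    exact div_le_one_of_le₀ (h.norm_center_sub_le j) h.R_pos.le)⟩
  let B : Fin M → unitBall p := fun i => ⟨(b' i - a) / (b - a), mem_unitBall.2 (by
    rw [norm_div, h.norm_b_sub_a]
    exact div_le_one_of_le₀ (mem_holedDisc.1 (h.arc_mem i)).1 h.R_pos.le)⟩
  have hne : ∀ z w : ℂ_[p], ‖z - w‖ = R → ¬ ‖(z - a) / (b - a) - (w - a) / (b - a)‖ < 1 := by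
    intro z w hzw
    rw [← sub_div, sub_sub_sub_cancel_right, norm_div, hzw, h.norm_b_sub_a, div_self h.R_pos.ne']
    exact lt_irrefl 1
  set T : Finset (Fin M) := Finset.univ.filter fun i => r i = R with hT
  have hTr : ∀ i ∈ T, r i = R := fun i hi => (Finset.mem_filter.1 hi).2
  have hBX : ∀ i ∈ T, ∀ j, res p (B i) ≠ res p (X j) := fun i hi j e =>
    hne _ _ (h.norm_arc_sub_center_eq (hTr i hi) j) ((res_eq_res_iff _ _).1 e)
  have hBB : Set.InjOn (fun i => res p (B i)) T := by
    intro i hi j hj e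
    by_contra hij
    refine hne (b' i) (b' j) ?_ ((res_eq_res_iff _ _).1 e)
    rcases h.lt_or_lt (hTr i hi) hij with h1 | h1
    · exact h.norm_arc_sub_arc i h1 j hij
    · rw [norm_sub_rev]
      exact h.norm_arc_sub_arc j h1 i (Ne.symm hij)
  have hXX : Set.InjOn (fun i => res p (X i)) T := by
    intro i hi j hj e
    by_contra hij
    refine hne (x i) (x j) ?_ ((res_eq_res_iff _ _).1 e)
    rcases h.lt_or_lt (hTr i hi) hij with h1 | h1
    · exact h.norm_center_sub_eq h1 hij
    · rw [norm_sub_rev]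
      exact h.norm_center_sub_eq h1 (Ne.symm hij)
  have hinj : Function.Injective fun t : resField p => t ^ p ^ n := by
    intro s t e
    simp only at e
    rwa [← sub_eq_zero, ← sub_pow_char_pow,
      pow_eq_zero_iff (pow_p_pos n).ne', sub_eq_zero] at e
  have hrow : ∀ i ∈ T, ∀ j, res p (W i j) = (res p (B i) - res p (X i)) ^ p ^ n /
      (res p (B i) ^ p ^ n - res p (X j) ^ p ^ n) := by
    intro i hi j
    have hri := hTr i hi
    have hd : b' i - x i ≠ 0 := sub_ne_zero.2 (h.center_ne i).symm
    have hu : ‖(x j - x i) / (b' i - x i)‖ ≤ 1 := by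
      rw [norm_div, h.norm_arc_sub_center, hri]
      exact div_le_one_of_le₀ (h.norm_center_sub_center_le j i) h.R_pos.le
    let U : unitBall p := ⟨_, mem_unitBall.2 hu⟩
    have e1 : U * (B i - X i) = X j - X i := by
      refine Subtype.ext ?_
      change (x j - x i) / (b' i - x i) * ((b' i - a) / (b - a) - (x i - a) / (b - a)) =
        (x j - a) / (b - a) - (x i - a) / (b - a)
      field_simp
      ring
    have e2 : W i j * (1 - U ^ p ^ n) = 1 := by
      refine Subtype.ext ?_
      change (1 - ((x j - x i) / (b' i - x i)) ^ p ^ n)⁻¹ *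
        (1 - ((x j - x i) / (b' i - x i)) ^ p ^ n) = 1
      exact inv_mul_cancel₀ (sub_ne_zero.2
        (pow_ne_one_of_one_le (h.one_le_norm_pole' i (h.center_notMem j)) n).symm)
    have f1 := congrArg (res p) e1
    have f2 := congrArg (res p) e2
    simp only [map_mul, map_sub, map_one, map_pow] at f1 f2
    have f3 : (1 - res p U) * (res p (B i) - res p (X i)) = res p (B i) - res p (X j) := by
      rw [sub_mul, one_mul, f1]
      ring
    rw [← sub_pow_char_pow, eq_div_iff (pow_ne_zero _ (sub_ne_zero.2 (hBX i hi j))), ← f3,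
      mul_pow, ← mul_assoc, sub_pow_char_pow, one_pow, f2, one_mul]
  by_contra! hlt
  rw [hdet] at hlt
  have h0 : ((res p).mapMatrix W).det = 0 := by
    rw [← RingHom.map_det]
    exact (res_eq_zero_iff _).2 hlt
  obtain ⟨c, hc0, hc⟩ := Matrix.exists_mulVec_eq_zero_iff.2 h0
  have hsum : ∀ i, ∑ j, res p (W i j) * c j = 0 := fun i => congrFun hc i
  have hcT : ∀ i, i ∉ T → c i = 0 := by
    intro i hi
    have hri : r i < R := lt_of_le_of_ne (h.r_bounds i).2 fun e => hi (by simp [hT, e])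
    have := hsum i
    rw [Finset.sum_eq_single i] at this
    · have e : W i i = 1 := Subtype.ext (weightMatrix_self n i)
      rwa [e, map_one, one_mul] at this
    · intro j _ hji
      rw [(res_eq_zero_iff (W i j)).2 (h.norm_weightMatrix_lt n
        (h.r_lt_norm_center_sub_of_r_lt hri hji.symm)), zero_mul]
    · exact fun hn => absurd (Finset.mem_univ i) hn
  have hz := eq_zero_of_cauchy_sum_eq_zero (T := T) (v := fun i => res p (B i) ^ p ^ n)
    (y := fun i => res p (X i) ^ p ^ n) (c := c) (fun i hi j hj e => hBB hi hj (hinj e))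
    (fun i hi j hj e => hXX hi hj (hinj e)) (fun i hi j _ e => hBX i hi j (hinj e)) (by
      intro i hi
      have h1 := hsum i
      rw [← Finset.sum_subset (Finset.subset_univ T) fun j _ hj => by rw [hcT j hj, mul_zero]] at h1
      have hk : (res p (B i) - res p (X i)) ^ p ^ n ≠ 0 :=
        pow_ne_zero _ (sub_ne_zero.2 (hBX i hi i))
      refine (mul_eq_zero.1 (?_ : (res p (B i) - res p (X i)) ^ p ^ n * _ = 0)).resolve_left hk
      rw [← h1, Finset.mul_sum]
      refine Finset.sum_congr rfl fun j _ => ?_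
      rw [hrow i hi j]
      ring)
  exact hc0 (funext fun i => if hi : i ∈ T then hz i hi else hcT i hi)
end IsConfig

/-! ### The coefficients -/

theorem ArcIntegrable.tendsto {α : ℕ} {a b : ℂ_[p]} {f : ℂ_[p] → ℂ_[p]}
    (h : ArcIntegrable (linFamily α) a b f) :
    Tendsto (arcMean a b f) (linFilter α) (𝓝 (arcIntegral (linFamily α) a b f)) := by
  obtain ⟨L, hL⟩ := h
  rw [hL.arcIntegral_eq (linFamily_interlocked α)]
  exact hasArcIntegral_iff.1 hL

theorem Approximable.arcIntegrable {D : Set ℂ_[p]} {a b : ℂ_[p]} (hab : a ≠ b)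
    (harc : arc a b ⊆ D) (α : ℕ) {f : ℂ_[p] → ℂ_[p]} (hf : Approximable D f) :
    ArcIntegrable (linFamily α) a b f := by
  obtain ⟨L, hL⟩ := hf.exists_tendsto_arcMean hab harc α
  exact ⟨L, hasArcIntegral_iff.2 hL⟩

namespace IsConfig

variable {M m : ℕ} {a b : ℂ_[p]} {R : ℝ} {x b' : Fin M → ℂ_[p]} {ρ r : Fin M → ℝ}

/-- The coefficients express the limits of the weights on the boundary arc through the rows of the
limit of the weight matrices; the latter is nonsingular since `‖det‖ ≥ 1` passes to the limit. -/
theorem exists_coeff (h : IsConfig m a b R x b' ρ r) (α : ℕ) :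
    ∃ μ : Fin M → ℂ_[p], ∀ j, Tendsto (fun n : ℕ => (1 - ((x j - a) / (b - a)) ^ p ^ n)⁻¹ -
      ∑ i, μ i * (1 - ((x j - x i) / (b' i - x i)) ^ p ^ n)⁻¹) (linFilter α) (𝓝 0) := by
  choose v hv using fun j => exists_tendsto_weight α (h.one_le_norm_pole (h.center_notMem j))
  choose W hW using fun i j => exists_tendsto_weight α (h.one_le_norm_pole' i (h.center_notMem j))
  have hWt : Tendsto (weightMatrix p x b') (linFilter α) (𝓝 (Matrix.of W)) :=
    tendsto_pi_nhds.2 fun i => tendsto_pi_nhds.2 fun j => hW i j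
  have hdet : 1 ≤ ‖(Matrix.of W).det‖ :=
    ge_of_tendsto' (((Continuous.matrix_det continuous_id).tendsto _).comp hWt).norm
      fun n => h.norm_det_weightMatrix n
  have hunit : IsUnit (Matrix.of W).det :=
    isUnit_iff_ne_zero.2 (norm_pos_iff.1 (zero_lt_one.trans_le hdet))
  refine ⟨Matrix.vecMul v (Matrix.of W)⁻¹, fun j => ?_⟩
  have e : v j = ∑ i, Matrix.vecMul v (Matrix.of W)⁻¹ i * W i j := by
    have : Matrix.vecMul (Matrix.vecMul v (Matrix.of W)⁻¹) (Matrix.of W) = v := by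
      rw [Matrix.vecMul_vecMul, Matrix.nonsing_inv_mul _ hunit, Matrix.vecMul_one]
    exact (congrFun this j).symm
  have := (hv j).sub (tendsto_finsetSum Finset.univ fun i _ =>
    (hW i j).const_mul (Matrix.vecMul v (Matrix.of W)⁻¹ i))
  rwa [e, sub_self] at this

theorem exists_arcIntegral_eq_sum (h : IsConfig m a b R x b' ρ r) (α : ℕ) :
    ∃ μ : Fin M → ℂ_[p], ∀ f, KrasnerAnalyticOn f (holedDisc a R x ρ) →
      arcIntegral (linFamily α) a b f =
        ∑ i, μ i * arcIntegral (linFamily α) (x i) (b' i) f := by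
  obtain ⟨μ, hμ⟩ := h.exists_coeff α
  refine ⟨μ, fun f hf => ?_⟩
  have hf' := hf.approximable (isClosed_holedDisc a R x ρ)
  have hpole : ∀ c ∉ holedDisc a R x ρ,
      Tendsto (fun n : ℕ => (1 - ((c - a) / (b - a)) ^ p ^ n)⁻¹ -
        ∑ i, μ i * (1 - ((c - x i) / (b' i - x i)) ^ p ^ n)⁻¹) (linFilter α) (𝓝 0) := by
    intro c hc
    by_cases hcj : ∃ j, ‖c - x j‖ < ρ j
    · obtain ⟨j, hj⟩ := hcj
      have h1 := (h.tendsto_weight_sub_center hc hj).mono_left (linFilter_le_atTop α)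
      have h2 := tendsto_finsetSum Finset.univ fun i _ =>
        ((h.tendsto_weight_sub_center' hc hj i).mono_left (linFilter_le_atTop α)).const_mul (μ i)
      have h3 := (h1.sub h2).add (hμ j)
      simp only [mul_zero, Finset.sum_const_zero, sub_zero, add_zero] at h3
      refine h3.congr fun n => ?_
      simp only [mul_sub, Finset.sum_sub_distrib]
      ring
    · -- poles outside the large disc have weight `0` on every arc
      push Not at hcj
      have hca : R < ‖c - a‖ := by
        by_contra! hle
        exact hc (mem_holedDisc.2 ⟨hle, hcj⟩)
      have h1 : 1 < ‖(c - a) / (b - a)‖ := by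
        rwa [norm_div, h.norm_b_sub_a, one_lt_div h.R_pos]
      have h2 : ∀ i, 1 < ‖(c - x i) / (b' i - x i)‖ := by
        intro i
        have e : ‖c - x i‖ = ‖c - a‖ := by
          refine norm_eq_of_norm_sub_lt ?_
          rw [sub_sub_sub_cancel_left, norm_sub_rev]
          exact (h.norm_center_sub_le i).trans_lt hca
        rw [norm_div, h.norm_arc_sub_center, one_lt_div (h.r_pos i), e]
        exact (h.r_bounds i).2.trans_lt hca
      have h3 := (tendsto_weight_zero h1).sub (tendsto_finsetSum Finset.univ fun i _ =>
        (tendsto_weight_zero (h2 i)).const_mul (μ i))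
      simp only [mul_zero, Finset.sum_const_zero, sub_zero] at h3
      exact h3.mono_left (linFilter_le_atTop α)
  have hsum := hf'.tendsto_sum_arcMean (ι := Option (Fin M)) (A := fun o => o.elim a x)
    (B := fun o => o.elim b b') (κ := fun o => o.elim 1 fun i => -μ i)
    (by rintro (_ | i); exacts [h.ne, h.center_ne i])
    (by rintro (_ | i); exacts [h.arc_subset, h.arc_subset' i]) α (by
      intro c hc
      refine (hpole c hc).congr fun n => ?_
      simp [Fintype.sum_option, sub_eq_add_neg])
  have hlim := (hf'.arcIntegrable h.ne h.arc_subset α).tendsto.sub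
    (tendsto_finsetSum Finset.univ fun i _ =>
      (hf'.arcIntegrable (h.center_ne i) (h.arc_subset' i) α).tendsto.const_mul (μ i))
  refine sub_eq_zero.1 (tendsto_nhds_unique hlim (hsum.congr fun n => ?_))
  simp [Fintype.sum_option, sub_eq_add_neg]

end IsConfig

/-! ### Circles and arcs as point sets -/

theorem norm_two (hp : p ≠ 2) : ‖(2 : ℂ_[p])‖ = 1 := by
  have : ‖((2 : ℕ) : ℚ_[p])‖ = 1 := Padic.norm_natCast_eq_one_iff.2
    ((Nat.coprime_primes Fact.out Nat.prime_two).2 hp)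
  rw [← norm_algebraMap' ℂ_[p], map_natCast] at this
  exact_mod_cast this

/-- A circle determines its radius, because the reflection `2 * a - b` of a point `b` of the circle
lies at distance `‖2‖ * R = R` from `b`. -/
theorem radius_le_of_sphere_eq (hp : p ≠ 2) {a a' b : ℂ_[p]} {R R' : ℝ}
    (hb : b ∈ Metric.sphere a R) (h : Metric.sphere a R = Metric.sphere a' R') : R ≤ R' := by
  have hc : 2 * a - b ∈ Metric.sphere a R := by
    rw [mem_sphere_iff_norm] at hb ⊢
    rw [← hb, ← norm_neg (b - a)]
    congr 1
    ring
  have e : ‖(2 * a - b - a') - (b - a')‖ = R := by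
    rw [show (2 * a - b - a') - (b - a') = 2 * (a - b) by ring, norm_mul, norm_two hp, one_mul,
      norm_sub_rev, mem_sphere_iff_norm.1 hb]
  rw [h] at hb hc
  rw [← e]
  exact (norm_sub_le_max _ _).trans
    (max_le (mem_sphere_iff_norm.1 hc).le (mem_sphere_iff_norm.1 hb).le)

theorem norm_center_sub_lt_of_sphere_eq {a a' b : ℂ_[p]} {R : ℝ} (hR : 0 < R)
    (hb : b ∈ Metric.sphere a R) (h : Metric.sphere a R = Metric.sphere a' R) :
    ‖a' - a‖ < R := by
  have hb' := hb
  rw [h, mem_sphere_iff_norm] at hb'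
  rw [mem_sphere_iff_norm] at hb
  have hle : ‖a' - a‖ ≤ R := by
    rw [← sub_sub_sub_cancel_left _ _ b]
    exact (norm_sub_le_max _ _).trans (max_le hb.le hb'.le)
  refine lt_of_le_of_ne hle fun e => ?_
  have : a' ∈ Metric.sphere a' R := h ▸ mem_sphere_iff_norm.2 e
  rw [mem_sphere_iff_norm, sub_self, norm_zero] at this
  exact hR.ne this

/-- The integral over an arc depends only on the circle and on the arc as point sets. -/
theorem Approximable.arcIntegral_eq (hp : p ≠ 2) {D : Set ℂ_[p]} {a b a' b' : ℂ_[p]} {R R' : ℝ}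
    (hR : 0 < R) (hb : b ∈ Metric.sphere a R) (hb' : b' ∈ Metric.sphere a' R')
    (hs : Metric.sphere a R = Metric.sphere a' R') (hA : arc a b = arc a' b')
    (harc : arc a b ⊆ D) (α : ℕ) {f : ℂ_[p] → ℂ_[p]} (hf : Approximable D f) :
    arcIntegral (linFamily α) a b f = arcIntegral (linFamily α) a' b' f := by
  obtain rfl : R = R' :=
    le_antisymm (radius_le_of_sphere_eq hp hb hs) (radius_le_of_sphere_eq hp hb' hs.symm)
  have haa := norm_center_sub_lt_of_sphere_eq hR hb hs
  have hba := mem_sphere_iff_norm.1 hb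
  have hba' := mem_sphere_iff_norm.1 hb'
  have hbb : ‖b' - b‖ < R := by
    have : b' ∈ arc a b := by
      rw [hA, arc, hba']
      exact Metric.mem_ball_self hR
    rwa [arc, hba, Metric.mem_ball, dist_eq_norm] at this
  have hab : a ≠ b := by
    rintro rfl
    rw [sub_self, norm_zero] at hba
    exact hR.ne hba
  have hab' : a' ≠ b' := by
    rintro rfl
    rw [sub_self, norm_zero] at hba'
    exact hR.ne hba'
  have harc' : arc a' b' ⊆ D := hA ▸ harc
  have hpole : ∀ c ∉ D, Tendsto (fun n : ℕ => (1 - ((c - a) / (b - a)) ^ p ^ n)⁻¹ -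
      (1 - ((c - a') / (b' - a')) ^ p ^ n)⁻¹) atTop (𝓝 0) := by
    intro c hc
    refine tendsto_weight_sub (one_le_norm_pole hab fun h => hc (harc h))
      (one_le_norm_pole hab' fun h => hc (harc' h)) ?_
    rcases le_or_gt ‖c - a‖ R with hca | hca
    · left
      have h1 : b - a ≠ 0 := sub_ne_zero.2 hab.symm
      have h2 : b' - a' ≠ 0 := sub_ne_zero.2 hab'.symm
      have e : (c - a) / (b - a) - (c - a') / (b' - a') =
          ((c - a) * ((b' - b) - (a' - a)) + (a' - a) * (b - a)) / ((b - a) * (b' - a')) := by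
        field_simp
        ring
      rw [e, norm_div, norm_mul, hba, hba', div_lt_one (mul_pos hR hR)]
      refine (IsUltrametricDist.norm_add_le_max _ _).trans_lt (max_lt ?_ ?_)
      · rw [norm_mul]
        exact mul_lt_mul_of_le_of_lt_of_nonneg_of_pos hca
          ((norm_sub_le_max _ _).trans_lt (max_lt hbb haa)) (norm_nonneg _) hR
      · rw [norm_mul, hba]
        exact mul_lt_mul_of_pos_right haa hR
    · right
      have e : ‖c - a'‖ = ‖c - a‖ := by
        refine norm_eq_of_norm_sub_lt ?_
        rw [sub_sub_sub_cancel_left, norm_sub_rev]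
        exact haa.trans hca
      rw [norm_div, norm_div, hba, hba', e, one_lt_div hR]
      exact ⟨hca, hca⟩
  have hsum := hf.tendsto_sum_arcMean (A := ![a, a']) (B := ![b, b']) (κ := ![1, -1])
    (by rw [Fin.forall_fin_two]; exact ⟨hab, hab'⟩)
    (by rw [Fin.forall_fin_two]; exact ⟨harc, harc'⟩) α (fun c hc =>
      ((hpole c hc).mono_left (linFilter_le_atTop α)).congr fun n => by
        simp [Fin.sum_univ_two, sub_eq_add_neg])
  have hlim := (hf.arcIntegrable hab harc α).tendsto.sub (hf.arcIntegrable hab' harc' α).tendsto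
  refine sub_eq_zero.1 (tendsto_nhds_unique hlim (hsum.congr fun n => ?_))
  simp [Fin.sum_univ_two, sub_eq_add_neg]

/-- Two configurations with the same region, circles and arcs admit the same coefficients. -/
theorem exists_coeff_of_sets (hp : p ≠ 2) {M : ℕ} (α : ℕ) (region circle₀ arc₀ : Set ℂ_[p])
    (circles arcs : Fin M → Set ℂ_[p]) :
    ∃ μ : Fin M → ℂ_[p], ∀ (m : ℕ) (a b : ℂ_[p]) (R : ℝ) (x b' : Fin M → ℂ_[p]) (ρ r : Fin M → ℝ),
      IsConfig m a b R x b' ρ r → holedDisc a R x ρ = region → Metric.sphere a R = circle₀ →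
      arc a b = arc₀ → (∀ j, Metric.sphere (x j) (r j) = circles j) →
      (∀ j, arc (x j) (b' j) = arcs j) → ∀ f, KrasnerAnalyticOn f region →
        arcIntegral (linFamily α) a b f =
          ∑ i, μ i * arcIntegral (linFamily α) (x i) (b' i) f := by
  by_cases hex : ∃ (m : ℕ) (a b : ℂ_[p]) (R : ℝ) (x b' : Fin M → ℂ_[p]) (ρ r : Fin M → ℝ),
      IsConfig m a b R x b' ρ r ∧ holedDisc a R x ρ = region ∧ Metric.sphere a R = circle₀ ∧
      arc a b = arc₀ ∧ (∀ j, Metric.sphere (x j) (r j) = circles j) ∧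
      ∀ j, arc (x j) (b' j) = arcs j
  · obtain ⟨m₀, a₀, b₀, R₀, x₀, b₀', ρ₀, r₀, h₀, rfl, rfl, rfl, hC₀, hA₀⟩ := hex
    obtain ⟨μ, hμ⟩ := h₀.exists_arcIntegral_eq_sum α
    refine ⟨μ, fun m a b R x b' ρ r h _ hS hA hC hAs f hf => ?_⟩
    have hf' := hf.approximable (isClosed_holedDisc a₀ R₀ x₀ ρ₀)
    rw [← hf'.arcIntegral_eq hp h₀.R_pos h₀.b_mem h.b_mem hS.symm hA.symm h₀.arc_subset α, hμ f hf]
    refine Finset.sum_congr rfl fun i _ => ?_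
    rw [hf'.arcIntegral_eq hp (h₀.r_pos i) (h₀.arc_mem_sphere i) (h.arc_mem_sphere i)
      ((hC₀ i).trans (hC i).symm) ((hA₀ i).trans (hAs i).symm) (h₀.arc_subset' i) α]
  · exact ⟨0, fun m a b R x b' ρ r h h1 h2 h3 h4 h5 =>
      absurd ⟨m, a, b, R, x, b', ρ, r, h, h1, h2, h3, h4, h5⟩ hex⟩

end PadicArc

end

open PadicArc in
/-- Cauchy-Goursat theorem for arcs. The coefficients `μ` are a function of `α`, the region, its
boundary circle `C` with the arc `𝒜(a, b)` of it, and, for each hole, the circle `C_i` with the arc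
`𝒜(x_i, b_i)` of it, all of these as point sets. The holes with index `i < m` have radius `R`. -/
theorem mainTheorem3 (p : ℕ) [Fact p.Prime] (hp : p ≠ 2) (M : ℕ) :
    ∃ μ : (α : ℕ) → (region circle₀ arc₀ : Set ℂ_[p]) → (circles arcs : Fin M → Set ℂ_[p]) →
        Fin M → ℂ_[p],
      ∀ (α m : ℕ) (_ : m ≤ M) (a b : ℂ_[p]) (R : ℝ) (x b' : Fin M → ℂ_[p]) (ρ r : Fin M → ℝ),
        0 < R →
        (∀ i, 0 < ρ i) →
        (∀ i : Fin M, (i : ℕ) < m → ρ i = R) →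
        (∀ i : Fin M, m ≤ (i : ℕ) → ρ i < R) →
        (∀ i : Fin M, (i : ℕ) < m → ‖a - x i‖ = R) →
        (∀ i j, i ≠ j → Disjoint (Metric.ball (x i) (ρ i)) (Metric.ball (x j) (ρ j))) →
        b ∈ Metric.sphere a R →
        (∀ i, ‖b - x i‖ = R) →
        (∀ i, ρ i ≤ r i ∧ r i ≤ R) →
        (∀ i j : Fin M, m ≤ (i : ℕ) → m ≤ (j : ℕ) → i ≠ j →
          Disjoint (Metric.closedBall (x i) (r i)) (Metric.closedBall (x j) (r j))) →
        (∀ i, b' i ∈ Metric.sphere (x i) (r i)) →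
        (∀ i, b' i ∈ holedDisc a R x ρ) →
        (∀ i : Fin M, (i : ℕ) < m → ∀ j, ‖b' i - x j‖ = R) →
        (∀ i : Fin M, (i : ℕ) < m → ∀ j, i ≠ j → ‖b' i - b' j‖ = R) →
        ∀ f : ℂ_[p] → ℂ_[p], KrasnerAnalyticOn f (holedDisc a R x ρ) →
          ArcIntegrable (linFamily α) a b f ∧
          (∀ i, ArcIntegrable (linFamily α) (x i) (b' i) f) ∧
          arcIntegral (linFamily α) a b f =
            ∑ i, μ α (holedDisc a R x ρ) (Metric.sphere a R) (arc a b)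
                (fun j => Metric.sphere (x j) (r j)) (fun j => arc (x j) (b' j)) i *
              arcIntegral (linFamily α) (x i) (b' i) f := by
  choose μ hμ using fun (α : ℕ) (region circle₀ arc₀ : Set ℂ_[p])
    (circles arcs : Fin M → Set ℂ_[p]) => exists_coeff_of_sets hp α region circle₀ arc₀ circles arcs
  refine ⟨μ, fun α m _ a b R x b' ρ r h1 h2 h3 h4 _ h6 h7 h8 h9 h10 h11 h12 h13 h14 f hf => ?_⟩
  have h : IsConfig m a b R x b' ρ r := ⟨h1, h2, h3, h4, h6, h7, h8, h9, h10, h11, h12, h13, h14⟩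
  have hf' := hf.approximable (isClosed_holedDisc a R x ρ)
  exact ⟨hf'.arcIntegrable h.ne h.arc_subset α,
    fun i => hf'.arcIntegrable (h.center_ne i) (h.arc_subset' i) α,
    hμ _ _ _ _ _ _ m a b R x b' ρ r h rfl rfl rfl (fun _ => rfl) (fun _ => rfl) f hf⟩
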